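/- Let $2\le n\le\infty$ and let $\mathcal O_n$ be the Cuntz algebra, i.e. the universal unital C*-algebra generated by $s_1,\dots,s_n$ (by $s_1,s_2,\dots$ if $n=\infty$) with $s_i^*s_j=\delta_{ij}1$ and $\sum_{i=1}^n s_is_i^*=1$ if $n<\infty$, respectively $\sum_{i=1}^k s_is_i^*\le 1$ for all $k$ if $n=\infty$. For a word $J=(j_1,\dots,j_l)$ put $s_J=s_{j_1}\cdots s_{j_l}$, $s_\emptyset=1$. Call two states $\omega,\omega'$ on $\mathcal O_n$ equivalent, $\omega\sim\omega'$, if their GNS representations are unitarily equivalent. For a state $\omega$ with GNS representation $(\mathcal H,\pi,\Omega)$ let $\mathcal K(\omega)\subset\mathcal H$ be the closed linear span of the vectors $\pi(s_J)^*\Omega$, over all words $J$, and put $$\operatorname{cdim}\omega=\dim\mathcal K(\omega)\in\{1,2,\dots,\infty\},\qquad \kappa(\omega)=\min\{\operatorname{cdim}\omega' : \omega'\sim\omega\}.$$ The state $\omega$ is called minimal if $\operatorname{cdim}\omega=\kappa(\omega)$. **Theorem.** For every $2\le n\le\infty$ and every $1\le d\le\infty$ there is a set $S$ of states on $\mathcal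 O_n$, of the cardinality of the continuum, whose elements are pure, minimal, satisfy $\kappa(\omega)=d$, and are pairwise inequivalent. Moreover, $S$ can be chosen as follows. (i) If $d<\infty$, then for every $c\in U(1)=\{c\in\mathbb C:|c|=1\}$ there is exactly one sub-Cuntz state $\rho_c$ by the unit vector $z=\bar c\,e_2^{\otimes(d-1)}\otimes e_1\in\ell^2(\{1,\dots,n\}^d)$, that is, exactly one state with $\rho_c(s_J)=\overline{z_J}$ for all words $J$ of length $d$, and $S=\{\rho_c: c\in U(1)\}$. (ii) If $d=\infty$, let $\Lambda$ be the set of infinite sequences in $\{1,\dots,n\}$ (in $\{1,2,\dots\}$ if $n=\infty$). There is a shift representation $\Pi$ of $\mathcal O_n$ on $\ell^2(\Lambda)$, that is, a unital $*$-representation with $\Pi(s_i)e_x=e_{ix}$ for all $i$ and all $x\in\Lambda$, and $S=\{\omega_x : x\in R\}$, where $\omega_x=\langle e_x,\Pi(\cdot)e_x\rangle$ and $R\subset\Lambda$ contains exactly one element of each tail-equivalence class of sequences that are not eventually periodic. (Sequences $x,y$ are tail equivalent if $x_{k+p}=y_{k+q}$ for some $p,q$ and all $k\ge1$; $x$ is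 eventually periodic if for some $p\ge1$ one has $x_{i+p}=x_i$ for all sufficiently large $i$.) -/

import Mathlib

open scoped ComplexOrder ENNReal

noncomputable section

namespace Cuntz

/-! ### Cuntz families and the Cuntz algebra -/

/-- The index set of the generators of `O_n`, `2 ≤ n ≤ ∞`: the natural numbers `i < n`
(all natural numbers if `n = ∞`). The generator usually called `s_{i+1}` has index `i`. -/
abbrev Idx (n : ℕ∞) : Type := {i : ℕ // (i : ℕ∞) < n}

/-- A family in a unital C⋆-algebra that satisfies the Cuntz relations:
`s_i^* s_j = δ_{ij} 1`, and `∑ s_i s_i^* = 1` if `n < ∞`, respectively `∑_{i ∈ F} s_i s_i^* ≤ 1` for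
every finite set `F` of indices if `n = ∞`. Here `x ≤ 1` is written as `1 - x = b^* b` for some
`b`. -/
structure IsCuntzFamily {n : ℕ∞} {A : Type*} [CStarAlgebra A] (s : Idx n → A) : Prop where
  star_mul_self : ∀ i, star (s i) * s i = 1
  star_mul_of_ne : ∀ i j, i ≠ j → star (s i) * s j = 0
  sum_eq_one : n ≠ ⊤ → ∑ᶠ i, s i * star (s i) = 1
  sum_le_one : n = ⊤ → ∀ F : Finset (Idx n), ∃ b : A, 1 - ∑ i ∈ F, s i * star (s i) = star b * b

/-- In the presence of the first relations, `1 - ∑_{i ∈ F} s_i s_i^*` is a projection. -/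
theorem exists_one_sub_sum_eq {ι A : Type*} [CStarAlgebra A] {s : ι → A}
    (h₁ : ∀ i, star (s i) * s i = 1) (h₂ : ∀ i j, i ≠ j → star (s i) * s j = 0) (F : Finset ι) :
    ∃ b : A, 1 - ∑ i ∈ F, s i * star (s i) = star b * b := by
  classical
  have hp : (∑ i ∈ F, s i * star (s i)) * (∑ i ∈ F, s i * star (s i))
      = ∑ i ∈ F, s i * star (s i) := by
    rw [Finset.sum_mul_sum]
    refine Finset.sum_congr rfl fun i hi => ?_
    rw [Finset.sum_eq_single i]
    · rw [mul_assoc, ← mul_assoc (star (s i)), h₁, one_mul]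
    · intro j _ hj
      rw [mul_assoc, ← mul_assoc (star (s i)), h₂ i j hj.symm, zero_mul, mul_zero]
    · exact fun h => absurd hi h
  refine ⟨1 - ∑ i ∈ F, s i * star (s i), ?_⟩
  have hs : star (1 - ∑ i ∈ F, s i * star (s i)) = 1 - ∑ i ∈ F, s i * star (s i) := by
    simp [star_sub, star_sum]
  rw [hs, mul_sub, mul_one, sub_mul, one_mul, hp, sub_self, sub_zero]

/-- A realization of the Cuntz relations in some nonzero unital C⋆-algebra. It is enough to let the
C⋆-algebra range over `Type`: a C⋆-algebra with countably many generators has at most continuum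
many elements, so it has a copy there. -/
structure Realization (n : ℕ∞) : Type 1 where
  carrier : Type
  [cstarAlgebra : CStarAlgebra carrier]
  [nontrivial : Nontrivial carrier]
  gen : Idx n → carrier
  isCuntzFamily : IsCuntzFamily gen

attribute [instance] Realization.cstarAlgebra Realization.nontrivial

/-- The bounded product of all realizations of the Cuntz relations. -/
abbrev RealizationProd (n : ℕ∞) : Type 1 := lp (fun r : Realization n => r.carrier) ∞

instance (n : ℕ∞) : CStarAlgebra (RealizationProd n) where

theorem norm_gen_le (n : ℕ∞) (i : Idx n) (r : Realization n) : ‖r.gen i‖ ≤ 1 := by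
  have h := CStarRing.norm_star_mul_self (x := r.gen i)
  rw [r.isCuntzFamily.star_mul_self i, norm_one] at h
  nlinarith [norm_nonneg (r.gen i)]

/-- The tuple of the `i`-th generators of all realizations. -/
def prodGen (n : ℕ∞) (i : Idx n) : RealizationProd n :=
  ⟨fun r => r.gen i, memℓp_infty ⟨1, by rintro _ ⟨r, rfl⟩; exact norm_gen_le n i r⟩⟩

/-- The C⋆-subalgebra generated by these tuples. -/
def cuntzSubalgebra (n : ℕ∞) : StarSubalgebra ℂ (RealizationProd n) :=
  (StarAlgebra.adjoin ℂ (Set.range (prodGen n))).topologicalClosure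

/-- The Cuntz algebra `O_n`: the universal C⋆-algebra for the Cuntz relations, constructed in the
usual way, as the C⋆-algebra generated by the generic family in the product of all
realizations. -/
def CuntzAlgebra (n : ℕ∞) : Type 1 := cuntzSubalgebra n

instance cstarAlgebraCuntzAlgebra (n : ℕ∞) : CStarAlgebra (CuntzAlgebra n) :=
  StarSubalgebra.cstarAlgebra (cuntzSubalgebra n)
    (h_closed := StarSubalgebra.isClosed_topologicalClosure _)

/-- The Cuntz generators of `O_n`. -/
def gen {n : ℕ∞} (i : Idx n) : CuntzAlgebra n :=
  ⟨prodGen n i, StarSubalgebra.le_topologicalClosure _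
    (StarAlgebra.subset_adjoin ℂ _ (Set.mem_range_self i))⟩

/-- The inclusion of `O_n` into the product of all realizations. -/
def incl (n : ℕ∞) : CuntzAlgebra n →⋆ₐ[ℂ] RealizationProd n := (cuntzSubalgebra n).subtype

/-- The coordinate of `O_n` at a realization. -/
def eval {n : ℕ∞} (r : Realization n) : CuntzAlgebra n →⋆ₐ[ℂ] r.carrier where
  toFun a := (incl n a : RealizationProd n) r
  map_one' := by rw [map_one]; rfl
  map_mul' a b := by rw [map_mul]; rfl
  map_zero' := by rw [map_zero]; rfl
  map_add' a b := by rw [map_add]; rfl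
  commutes' z := by rw [AlgHomClass.commutes]; rfl
  map_star' a := by rw [map_star]; rfl

theorem eval_gen {n : ℕ∞} (r : Realization n) (i : Idx n) : eval r (gen i) = r.gen i := rfl

theorem ext_eval {n : ℕ∞} {a b : CuntzAlgebra n} (h : ∀ r, eval r a = eval r b) : a = b :=
  Subtype.ext (lp.ext (funext h))

/-- The generators satisfy the Cuntz relations. -/
theorem isCuntzFamily_gen (n : ℕ∞) : IsCuntzFamily (gen (n := n)) := by
  have h₁ : ∀ i : Idx n, star (gen i) * gen i = 1 := fun i => ext_eval fun r => by
    simp only [map_mul, map_star, map_one, eval_gen, r.isCuntzFamily.star_mul_self]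
  have h₂ : ∀ i j : Idx n, i ≠ j → star (gen i) * gen j = 0 := fun i j hij => ext_eval fun r => by
    simp only [map_mul, map_star, map_zero, eval_gen, r.isCuntzFamily.star_mul_of_ne i j hij]
  refine ⟨h₁, h₂, fun hn => ?_, fun _ F => exists_one_sub_sum_eq h₁ h₂ F⟩
  lift n to ℕ using hn
  have : Finite (Idx n) :=
    Finite.of_injective (β := Fin n) (fun i => ⟨i.1, by exact_mod_cast i.2⟩) fun i j h =>
      Subtype.ext (by simpa using h)
  have := Fintype.ofFinite (Idx n)
  refine ext_eval fun r => ?_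
  have h := r.isCuntzFamily.sum_eq_one (ENat.natCast_ne_top n)
  rw [finsum_eq_sum_of_fintype] at h ⊢
  simp only [map_sum, map_mul, map_star, map_one, eval_gen, h]

theorem continuous_hom {A B : Type*} [CStarAlgebra A] [CStarAlgebra B] (χ : A →⋆ₐ[ℂ] B) :
    Continuous χ :=
  AddMonoidHomClass.continuous_of_bound χ 1 fun a => by
    simpa using NonUnitalStarAlgHom.norm_apply_le χ a

/-- `O_n` is generated by its generators as a C⋆-algebra. -/
theorem dense_adjoin_gen (n : ℕ∞) :
    Dense (StarAlgebra.adjoin ℂ (Set.range (gen (n := n))) : Set (CuntzAlgebra n)) := by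
  have key : ∀ y ∈ StarAlgebra.adjoin ℂ (Set.range (prodGen n)),
      ∃ b ∈ StarAlgebra.adjoin ℂ (Set.range (gen (n := n))), incl n b = y := by
    intro y hy
    induction hy using StarAlgebra.adjoin_induction with
    | mem y hy =>
      obtain ⟨i, rfl⟩ := hy
      exact ⟨gen i, StarAlgebra.subset_adjoin ℂ _ (Set.mem_range_self i), rfl⟩
    | algebraMap z => exact ⟨algebraMap ℂ _ z, algebraMap_mem _ z, AlgHomClass.commutes _ z⟩
    | add x y _ _ hx hy =>
      obtain ⟨a, ha, rfl⟩ := hx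
      obtain ⟨b, hb, rfl⟩ := hy
      exact ⟨a + b, add_mem ha hb, map_add _ _ _⟩
    | mul x y _ _ hx hy =>
      obtain ⟨a, ha, rfl⟩ := hx
      obtain ⟨b, hb, rfl⟩ := hy
      exact ⟨a * b, mul_mem ha hb, map_mul _ _ _⟩
    | star x _ hx =>
      obtain ⟨a, ha, rfl⟩ := hx
      exact ⟨star a, star_mem ha, map_star _ _⟩
  intro a
  have hi : Topology.IsInducing (incl n) := Topology.IsInducing.subtypeVal
  refine (closure_mono (s := incl n ⁻¹' (StarAlgebra.adjoin ℂ (Set.range (prodGen n))))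
    fun b hb => ?_) (hi.closure_eq_preimage_closure_image _ ▸ ?_)
  · obtain ⟨b', hb', h⟩ := key _ hb
    exact (Subtype.ext h : b' = b) ▸ hb'
  · have ha : incl n a ∈ closure (StarAlgebra.adjoin ℂ (Set.range (prodGen n)) : Set _) := a.2
    refine closure_mono (fun y hy => ?_) ha
    obtain ⟨b, _, rfl⟩ := key y hy
    exact ⟨b, hy, rfl⟩

/-- The universal property: every Cuntz family in a nonzero unital C⋆-algebra is the image of the
generators under exactly one unital `*`-homomorphism. -/
theorem existsUnique_hom {n : ℕ∞} {B : Type} [CStarAlgebra B] [Nontrivial B] (t : Idx n → B)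
    (ht : IsCuntzFamily t) : ∃! φ : CuntzAlgebra n →⋆ₐ[ℂ] B, ∀ i, φ (gen i) = t i := by
  refine ⟨eval ⟨B, t, ht⟩, fun i => rfl, fun ψ hψ => ?_⟩
  have hc : ∀ χ : CuntzAlgebra n →⋆ₐ[ℂ] B, Continuous χ := fun χ => continuous_hom χ
  refine StarAlgHomClass.ext_topologicalClosure (R := ℂ) (A := RealizationProd n)
    (F := CuntzAlgebra n →⋆ₐ[ℂ] B) (S := StarAlgebra.adjoin ℂ (Set.range (prodGen n)))
    (hc ψ) (hc _) fun x => ?_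
  refine StarAlgebra.adjoin_induction_subtype x ?_ ?_ ?_ ?_ ?_
  · rintro _ ⟨i, rfl⟩
    exact hψ i
  · intro z
    exact (AlgHomClass.commutes ψ z).trans (AlgHomClass.commutes (eval ⟨B, t, ht⟩) z).symm
  · intro x y hx hy
    exact (map_add ψ _ _).trans ((congrArg₂ _ hx hy).trans (map_add (eval ⟨B, t, ht⟩) _ _).symm)
  · intro x y hx hy
    exact (map_mul ψ _ _).trans ((congrArg₂ _ hx hy).trans (map_mul (eval ⟨B, t, ht⟩) _ _).symm)
  · intro x hx
    exact (map_star ψ _).trans ((congrArg _ hx).trans (map_star (eval ⟨B, t, ht⟩) _).symm)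

-- From here on, only the C⋆-algebra structure and the universal property matter.
attribute [irreducible] cstarAlgebraCuntzAlgebra

/-- The usual order of a C⋆-algebra: `a ≤ b` if and only if `b - a` is a positive element. -/
instance (n : ℕ∞) : PartialOrder (CuntzAlgebra n) := CStarAlgebra.spectralOrder _

instance (n : ℕ∞) : StarOrderedRing (CuntzAlgebra n) := CStarAlgebra.spectralOrderedRing _

/-! ### States, purity, equivalence -/

/-- States: positive linear functionals `f` with `f 1 = 1`. -/
abbrev State (A : Type*) [CStarAlgebra A] [PartialOrder A] : Type _ :=
  {f : A →ₚ[ℂ] ℂ // f 1 = 1}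

section States

variable {A : Type*} [CStarAlgebra A] [PartialOrder A]

/-- A state is pure if it is an extreme point of the state space. -/
def IsPure (ω : State A) : Prop :=
  ∀ (φ ψ : State A) (t : ℝ), 0 < t → t < 1 →
    (∀ a, ω.1 a = (t : ℂ) * φ.1 a + ((1 - t : ℝ) : ℂ) * ψ.1 a) → φ = ω ∧ ψ = ω

variable [StarOrderedRing A]

/-- The cyclic vector of the GNS representation. -/
def gnsVector (ω : State A) : ω.1.GNS := ((ω.1.toPreGNS 1 : ω.1.PreGNS) : ω.1.GNS)

/-- Two states are equivalent if their GNS representations are unitarily equivalent. -/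
def Equivalent (ω ω' : State A) : Prop :=
  ∃ U : ω.1.GNS ≃ₗᵢ[ℂ] ω'.1.GNS,
    ∀ (a : A) (v : ω.1.GNS), U (ω.1.gnsStarAlgHom a v) = ω'.1.gnsStarAlgHom a (U v)

end States

/-! ### The invariant `κ` and minimality -/

variable {n : ℕ∞}

/-- `s_J = s_{j_1} ⋯ s_{j_l}` for a word `J = (j_1, …, j_l)`, with `s_∅ = 1`. -/
def word (J : List (Idx n)) : CuntzAlgebra n := (J.map gen).prod

/-- `𝒦(ω)`, the closed linear span of the vectors `π(s_J)^* Ω` in the GNS space of `ω`, where `J`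
runs over all words. -/
def corrSpace (ω : State (CuntzAlgebra n)) : Submodule ℂ ω.1.GNS :=
  (Submodule.span ℂ (Set.range fun J : List (Idx n) =>
    ContinuousLinearMap.adjoint (ω.1.gnsStarAlgHom (word J)) (gnsVector ω))).topologicalClosure

/-- `cdim ω = dim 𝒦(ω)`, with value `⊤` if the dimension is infinite. -/
def cdim (ω : State (CuntzAlgebra n)) : ℕ∞ := Cardinal.toENat (Module.rank ℂ (corrSpace ω))

/-- `κ(ω)` is the least value of `cdim ω'` over the states `ω'` equivalent to `ω`. -/
def kappa (ω : State (CuntzAlgebra n)) : ℕ∞ :=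
  sInf {k | ∃ ω' : State (CuntzAlgebra n), Equivalent ω' ω ∧ cdim ω' = k}

/-- A state is minimal if it attains `κ`. -/
def IsMinimal (ω : State (CuntzAlgebra n)) : Prop := cdim ω = kappa ω

/-! ### Sub-Cuntz states -/

/-- `ω` is a sub-Cuntz state of order `m` by the unit vector `z ∈ ℓ²({1, …, n}^m)`:
`ω(s_J)` is the complex conjugate of `z_J` for all words `J` of length `m`. -/
def IsSubCuntzState {m : ℕ} (z : lp (fun _ : Fin m → Idx n => ℂ) 2)
    (ω : State (CuntzAlgebra n)) : Prop :=
  1 ≤ m ∧ ‖z‖ = 1 ∧ ∀ J : Fin m → Idx n, ω.1 (word (List.ofFn J)) = star (z J)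

/-- The first index. -/
def idxOne (hn : 2 ≤ n) : Idx n := ⟨0, lt_of_lt_of_le (by norm_num) hn⟩

/-- The second index. -/
def idxTwo (hn : 2 ≤ n) : Idx n := ⟨1, lt_of_lt_of_le (by norm_num) hn⟩

open Classical in
/-- The unit vector `c̄ e_2^{⊗ (m - 1)} ⊗ e_1`, for `c` in the unit circle. -/
def circleVector (hn : 2 ≤ n) (m : ℕ) (c : Circle) : lp (fun _ : Fin m → Idx n => ℂ) 2 :=
  lp.single 2 (fun k : Fin m => if (k : ℕ) + 1 = m then idxOne hn else idxTwo hn) (star (c : ℂ))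

/-! ### The shift representation -/

/-- `Λ`: the infinite sequences of indices. -/
abbrev Seq (n : ℕ∞) : Type := ℕ → Idx n

/-- The concatenation `ix`. -/
def cons (i : Idx n) (x : Seq n) : Seq n
  | 0 => i
  | k + 1 => x k

/-- Tail equivalence. -/
def TailEquiv (x y : Seq n) : Prop := ∃ p q : ℕ, ∀ k, x (k + p) = y (k + q)

/-- `x` is eventually periodic. -/
def EventuallyPeriodic (x : Seq n) : Prop := ∃ i₀ p : ℕ, 1 ≤ p ∧ ∀ i, i₀ ≤ i → x (i + p) = x i

/-- The Hilbert space `ℓ²(Λ)`. -/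
abbrev SeqSpace (n : ℕ∞) : Type := lp (fun _ : Seq n => ℂ) 2

open Classical in
/-- The standard basis vector `e_x` of `ℓ²(Λ)`. -/
def basisVec (x : Seq n) : SeqSpace n := lp.single 2 x (1 : ℂ)

/-- `Π` is the shift representation: the unital `*`-representation of `O_n` on `ℓ²(Λ)` with
`Π(s_i) e_x = e_{ix}`. -/
def IsShiftRepresentation (P : CuntzAlgebra n →⋆ₐ[ℂ] (SeqSpace n →L[ℂ] SeqSpace n)) : Prop :=
  ∀ (i : Idx n) (x : Seq n), P (gen i) (basisVec x) = basisVec (cons i x)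

/-- `ω` is the vector state of the representation `P` at `v`. -/
def IsVectorState {H : Type*} [NormedAddCommGroup H] [InnerProductSpace ℂ H] [CompleteSpace H]
    (P : CuntzAlgebra n →⋆ₐ[ℂ] (H →L[ℂ] H)) (v : H) (ω : State (CuntzAlgebra n)) : Prop :=
  ∀ a, ω.1 a = inner ℂ v (P a v)

end Cuntz

end

noncomputable section

namespace Cuntz

section

variable {n : ℕ∞}

/-! ### Words -/

/-! All states in question are vector states of basis vectors `e_y` of `ℓ²(Λ)` in a representation
`s_i e_x = w_i e_{ix}` with `|w_i| = 1` (`shiftRep`). For `d = ∞` take `w = 1` and `y` not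
eventually periodic. For `d < ∞` let `y` have the period `2 ⋯ 2 1` of length `d`, with weight `c` at
the letter 1 and weight 1 elsewhere.

Purity and uniqueness: if `v` lies in the range of `s_K` for every initial word `K` of `y`, the
vectors `s_K^* v` form an orbit over `y`. The products `s_A s_B^*` span a dense subspace, so the
state of `v` depends only on inner products within the orbit, and these vanish between different
tails of `y` (`IsOrbit.inner_rep_eq`). Hence the values 1 at all `s_K s_K^*` determine the state if
`y` is not eventually periodic, and the single value `c` at `s_K`, `|K| = d`, determines it in the
periodic case. Such values have the largest possible modulus, so the state is extreme
(`isPure_of_unique`).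

Inequivalence: a state equivalent to that of `e_y` is the vector state of some `v` supported in the
tail class of `y` (`IsVectorState.of_equivalent`). If it is also the state of a basis vector `e_x`,
then `v` is a multiple of `e_x` (`equivalent_basisVec`).

Minimality: if `v` has a nonzero coefficient at `z`, then `s_K^* v` for long initial words `K` of
`z` is close to a multiple, of constant modulus, of the basis vector of the remaining tail. So
consecutive vectors `s_K^* v` are linearly independent as long as the tails differ
(`exists_linearIndependent_corrSpan`). This bounds `cdim` below on the whole equivalence class. For
`e_y` itself, the vectors `s_J^* e_y` are zero or multiples of tails of `y`, which gives the upper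
bound. -/

@[simp] theorem word_nil : word ([] : List (Idx n)) = 1 := rfl

@[simp] theorem word_cons (i : Idx n) (A : List (Idx n)) : word (i :: A) = gen i * word A := by
  simp [word]

theorem word_append (A B : List (Idx n)) : word (A ++ B) = word A * word B := by
  simp [word]

theorem star_gen_mul_gen (i j : Idx n) : star (gen i) * gen j = if i = j then 1 else 0 := by
  split_ifs with h
  · rw [h, (isCuntzFamily_gen n).star_mul_self]
  · exact (isCuntzFamily_gen n).star_mul_of_ne i j h

theorem star_word_mul_word (A : List (Idx n)) : star (word A) * word A = 1 := by
  induction A with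
  | nil => simp
  | cons i A ih =>
    rw [word_cons, star_mul, mul_assoc, ← mul_assoc (star (gen i)), star_gen_mul_gen, if_pos rfl,
      one_mul, ih]

theorem star_word_mul_word_of_ne {A B : List (Idx n)} (hl : A.length = B.length) (h : A ≠ B) :
    star (word A) * word B = 0 := by
  induction A generalizing B with
  | nil => exact absurd (List.eq_nil_of_length_eq_zero hl.symm).symm h
  | cons i A ih =>
    cases B with
    | nil => simp at hl
    | cons j B =>
      rw [word_cons, word_cons, star_mul, mul_assoc, ← mul_assoc (star (gen i)), star_gen_mul_gen]
      split_ifs with hij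
      · rw [one_mul]
        exact ih (by simpa using hl) fun hAB => h (by rw [hij, hAB])
      · simp

/-- The products `s_A s_B^*` span a dense subspace of `O_n`. -/
theorem mem_of_word_mul_star_word {M : Submodule ℂ (CuntzAlgebra n)}
    (hc : IsClosed (M : Set (CuntzAlgebra n)))
    (h : ∀ A B : List (Idx n), word A * star (word B) ∈ M) (a : CuntzAlgebra n) : a ∈ M := by
  set W : Submodule ℂ (CuntzAlgebra n) := Submodule.span ℂ
    (Set.range fun p : List (Idx n) × List (Idx n) => word p.1 * star (word p.2)) with hW
  have hmem : ∀ A B : List (Idx n), word A * star (word B) ∈ W := fun A B =>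
    Submodule.subset_span ⟨(A, B), rfl⟩
  have hmul : ∀ b : CuntzAlgebra n, (∀ A B : List (Idx n), b * (word A * star (word B)) ∈ W) →
      ∀ w ∈ W, b * w ∈ W := by
    intro b hb w hw
    induction hw using Submodule.span_induction with
    | mem w hw => obtain ⟨p, rfl⟩ := hw; exact hb _ _
    | zero => simp
    | add x y _ _ hx hy => rw [mul_add]; exact add_mem hx hy
    | smul z x _ hx => rw [mul_smul_comm]; exact W.smul_mem z hx
  -- The span is stable under left multiplication by the generators and by their adjoints. Carrying
  -- `x` and `star x` together makes the star case of the induction trivial.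
  have key : ∀ x ∈ StarAlgebra.adjoin ℂ (Set.range (gen (n := n))),
      ∀ w ∈ W, x * w ∈ W ∧ star x * w ∈ W := by
    intro x hx
    induction hx using StarAlgebra.adjoin_induction with
    | mem x hx =>
      obtain ⟨i, rfl⟩ := hx
      refine fun w hw => ⟨hmul _ (fun A B => ?_) w hw, hmul _ (fun A B => ?_) w hw⟩
      · rw [← mul_assoc, ← word_cons]; exact hmem _ _
      -- For empty `A` nothing cancels, but `s_i^* s_B^* = (s_B s_i)^*` is again of the required
      -- form.
      · cases A with
        | nil =>
          have := hmem [] (B ++ [i])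
          simpa [word_append] using this
        | cons j A =>
          rw [word_cons, ← mul_assoc, ← mul_assoc, star_gen_mul_gen]
          split_ifs
          · rw [one_mul]; exact hmem _ _
          · simp
    | algebraMap z =>
      intro w hw
      simp only [Algebra.algebraMap_eq_smul_one, star_smul, star_one, smul_mul_assoc, one_mul]
      exact ⟨W.smul_mem _ hw, W.smul_mem _ hw⟩
    | add x y _ _ hx hy =>
      intro w hw
      rw [star_add, add_mul, add_mul]
      exact ⟨add_mem (hx w hw).1 (hy w hw).1, add_mem (hx w hw).2 (hy w hw).2⟩
    | mul x y _ _ hx hy =>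
      intro w hw
      rw [star_mul, mul_assoc, mul_assoc]
      exact ⟨(hx _ (hy w hw).1).1, (hy _ (hx w hw).2).2⟩
    | star x _ hx =>
      intro w hw
      rw [star_star]
      exact (hx w hw).symm
  have h1 : (1 : CuntzAlgebra n) ∈ W := by simpa using hmem [] []
  have hWM : W ≤ M := Submodule.span_le.2 (by rintro _ ⟨p, rfl⟩; exact h _ _)
  refine hc.closure_subset_iff.2 (fun x hx => ?_) ((dense_adjoin_gen n) a)
  simpa using hWM (key x hx 1 h1).1

/-! ### Sequences -/

/-- The tail `x_k, x_{k+1}, …` of a sequence. -/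
def shift (x : Seq n) (k : ℕ) : Seq n := fun j => x (j + k)

/-- The word formed by the first `k` entries of a sequence. -/
def initial (x : Seq n) (k : ℕ) : List (Idx n) := List.ofFn fun j : Fin k => x j

@[simp] theorem shift_zero (x : Seq n) : shift x 0 = x := rfl

theorem shift_shift (x : Seq n) (k l : ℕ) : shift (shift x k) l = shift x (k + l) := by
  ext1 j
  simp only [shift]
  congr 1
  omega

@[simp] theorem length_initial (x : Seq n) (k : ℕ) : (initial x k).length = k := by simp [initial]

@[simp] theorem initial_zero (x : Seq n) : initial x 0 = [] := by simp [initial]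

theorem initial_succ (x : Seq n) (k : ℕ) : initial x (k + 1) = initial x k ++ [x k] := by
  rw [initial, List.ofFn_succ', List.concat_eq_append]
  rfl

theorem initial_succ_eq_cons (x : Seq n) (k : ℕ) :
    initial x (k + 1) = x 0 :: initial (shift x 1) k := by
  simp [initial, List.ofFn_succ, shift]

theorem word_initial_succ (x : Seq n) (k : ℕ) :
    word (initial x (k + 1)) = word (initial x k) * gen (x k) := by
  rw [initial_succ, word_append, word_cons, word_nil, mul_one]

/-! ### Representations and orbits -/

section Representation

variable {H : Type*} [NormedAddCommGroup H] [InnerProductSpace ℂ H] [CompleteSpace H]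
  (π : CuntzAlgebra n →⋆ₐ[ℂ] (H →L[ℂ] H))

theorem rep_mul (a b : CuntzAlgebra n) (v : H) : π (a * b) v = π a (π b v) := by
  rw [map_mul]; rfl

theorem rep_one (v : H) : π 1 v = v := by rw [map_one]; rfl

theorem inner_rep_star_left (a : CuntzAlgebra n) (v w : H) :
    inner ℂ (π (star a) v) w = inner ℂ v (π a w) := by
  rw [map_star, ContinuousLinearMap.star_eq_adjoint, ContinuousLinearMap.adjoint_inner_left]

theorem inner_rep_left (a : CuntzAlgebra n) (v w : H) :
    inner ℂ (π a v) w = inner ℂ v (π (star a) w) := by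
  rw [← inner_rep_star_left, star_star]

theorem inner_rep_rep (a : CuntzAlgebra n) (ha : star a * a = 1) (v w : H) :
    inner ℂ (π a v) (π a w) = inner ℂ v w := by
  rw [inner_rep_left, ← rep_mul, ha, rep_one]

theorem norm_rep_of_isometry (a : CuntzAlgebra n) (ha : star a * a = 1) (v : H) :
    ‖π a v‖ = ‖v‖ := by
  rw [norm_eq_sqrt_re_inner (𝕜 := ℂ), norm_eq_sqrt_re_inner (𝕜 := ℂ) v, inner_rep_rep π a ha]

theorem norm_rep_word (A : List (Idx n)) (v : H) : ‖π (word A) v‖ = ‖v‖ :=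
  norm_rep_of_isometry π _ (star_word_mul_word A) v

theorem norm_rep_star_word_le (A : List (Idx n)) (v : H) : ‖π (star (word A)) v‖ ≤ ‖v‖ := by
  have h : ‖π (star (word A)) v‖ ^ 2 ≤ ‖v‖ * ‖π (star (word A)) v‖ := by
    rw [sq, ← @inner_self_eq_norm_mul_norm ℂ, inner_rep_star_left]
    refine (re_inner_le_norm _ _).trans ?_
    rw [norm_rep_word]
  nlinarith [norm_nonneg (π (star (word A)) v), norm_nonneg v]

/-- The evaluation `a ↦ π(a)v` of a representation at a vector. -/
def repApply (v : H) : CuntzAlgebra n →L[ℂ] H :=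
  ContinuousLinearMap.apply ℂ H v ∘L
    ⟨(π : CuntzAlgebra n →ₗ[ℂ] (H →L[ℂ] H)), continuous_hom π⟩

/-- A sequence of vectors along which the representation moves like the shift along `y`. -/
def IsOrbit (y : Seq n) (u : ℕ → H) : Prop := ∀ k, π (gen (y k)) (u (k + 1)) = u k

variable {π} {y : Seq n} {u : ℕ → H}

theorem IsOrbit.word_initial (hu : IsOrbit π y u) (k l : ℕ) :
    π (word (initial (shift y k) l)) (u (k + l)) = u k := by
  induction l with
  | zero => simp
  | succ l ih =>
    have := hu (k + l)
    rw [word_initial_succ, rep_mul, shift, add_comm l k, ← add_assoc, this, ih]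

/-- Write `u k = s_K u (k + |A|)` with `K` the word of `y` of length `|A|` that starts at position
`k`. Words of equal length satisfy `s_A^* s_K = δ_{AK} 1`. -/
theorem IsOrbit.star_word (hu : IsOrbit π y u) (A : List (Idx n)) (k : ℕ) :
    π (star (word A)) (u k) = if A = initial (shift y k) A.length then u (k + A.length) else 0 := by
  rw [← hu.word_initial k A.length, ← rep_mul]
  split_ifs with h
  · rw [← h, star_word_mul_word, rep_one]
  · rw [star_word_mul_word_of_ne (by simp) h, map_zero]
    rfl

theorem IsOrbit.inner_succ (hu : IsOrbit π y u) (k l : ℕ) :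
    inner ℂ (u k) (u l) = if y k = y l then inner ℂ (u (k + 1)) (u (l + 1)) else (0 : ℂ) := by
  rw [← hu k, ← hu l, inner_rep_left, ← rep_mul, star_gen_mul_gen]
  split_ifs
  · rw [rep_one]
  · rw [map_zero]; exact inner_zero_right _

/-- Advance both vectors to a position where the tails disagree. There they lie in the ranges of two
different generators, which are orthogonal. -/
theorem IsOrbit.inner_eq_zero (hu : IsOrbit π y u) {k l : ℕ} (h : shift y k ≠ shift y l) :
    inner ℂ (u k) (u l) = (0 : ℂ) := by
  obtain ⟨j, hj⟩ := Function.ne_iff.1 h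
  have key : ∀ j k l, y (j + k) ≠ y (j + l) → inner ℂ (u k) (u l) = (0 : ℂ) := by
    intro j
    induction j with
    | zero =>
      intro k l h
      rw [hu.inner_succ, if_neg (by simpa using h)]
    | succ j ih =>
      intro k l h
      rw [hu.inner_succ, ih (k + 1) (l + 1), ite_self]
      rwa [← add_assoc, ← add_assoc, add_right_comm j k, add_right_comm j l]
  exact key j k l hj

/-- The vector state of the initial vector of an orbit over `y` is determined by the inner products
of those vectors of the orbit that belong to equal tails of `y`. -/
theorem IsOrbit.inner_rep_eq {H' : Type*} [NormedAddCommGroup H'] [InnerProductSpace ℂ H']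
    [CompleteSpace H'] {π' : CuntzAlgebra n →⋆ₐ[ℂ] (H' →L[ℂ] H')} {u' : ℕ → H'}
    (hu : IsOrbit π y u) (hu' : IsOrbit π' y u')
    (h : ∀ k l, shift y k = shift y l →
      (inner ℂ (u k) (u l) : ℂ) = inner ℂ (u' k) (u' l)) (a : CuntzAlgebra n) :
    (inner ℂ (u 0) (π a (u 0)) : ℂ) = inner ℂ (u' 0) (π' a (u' 0)) := by
  have hin : ∀ k l, (inner ℂ (u k) (u l) : ℂ) = inner ℂ (u' k) (u' l) := fun k l => by
    by_cases hkl : shift y k = shift y l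
    · exact h k l hkl
    · rw [hu.inner_eq_zero hkl, hu'.inner_eq_zero hkl]
  let F : CuntzAlgebra n →L[ℂ] ℂ :=
    innerSL ℂ (u 0) ∘L repApply π (u 0) - innerSL ℂ (u' 0) ∘L repApply π' (u' 0)
  have hF : ∀ b, F b = inner ℂ (u 0) (π b (u 0)) - inner ℂ (u' 0) (π' b (u' 0)) := fun b => rfl
  have := mem_of_word_mul_star_word (M := LinearMap.ker (F : CuntzAlgebra n →ₗ[ℂ] ℂ))
    (by exact F.isClosed_ker) (fun A B => by
    rw [LinearMap.mem_ker]
    refine (hF _).trans ?_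
    rw [rep_mul, rep_mul, ← inner_rep_star_left π (word A), ← inner_rep_star_left π' (word A),
      hu.star_word, hu.star_word, hu'.star_word, hu'.star_word]
    split_ifs <;> simp [hin]) a
  exact sub_eq_zero.1 ((hF a).symm.trans this)

/-- If `v` lies in the ranges of all `s_K`, `K` an initial word of `y`, then the vectors `s_K^* v`
form an orbit over `y`. -/
theorem isOrbit_of_norm_eq {v : H} (h : ∀ k, ‖π (star (word (initial y k))) v‖ = ‖v‖) :
    IsOrbit π y (fun k => π (star (word (initial y k))) v) := by
  -- Since `⟨v, s_K s_K^* v⟩ = ‖s_K^* v‖² = ‖v‖²`, expanding `‖s_K s_K^* v - v‖²` gives zero.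
  have h2 : ∀ k, π (word (initial y k)) (π (star (word (initial y k))) v) = v := by
    intro k
    have h3 : (inner ℂ v (π (word (initial y k)) (π (star (word (initial y k))) v)) : ℂ)
        = (‖v‖ : ℂ) ^ 2 := by
      rw [← inner_rep_star_left, inner_self_eq_norm_sq_to_K, h]
      rfl
    rw [← sub_eq_zero, ← norm_eq_zero, ← sq_eq_zero_iff, @norm_sub_sq ℂ, norm_rep_word, h,
      ← inner_conj_symm, h3]
    simp [← Complex.ofReal_pow]
    ring
  intro k
  have h3 := congrArg (π (star (word (initial y k)))) (h2 (k + 1))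
  rwa [word_initial_succ, rep_mul, ← rep_mul π (star _), star_word_mul_word, rep_one,
    ← word_initial_succ] at h3

end Representation

end

section

variable {n : ℕ∞}

/-! ### Vector states and the GNS representation -/

theorem state_ext {ω ω' : State (CuntzAlgebra n)} (h : ∀ a, ω.1 a = ω'.1 a) : ω = ω' :=
  Subtype.ext (DFunLike.ext _ _ h)

section Vector

variable {H : Type*} [NormedAddCommGroup H] [InnerProductSpace ℂ H] [CompleteSpace H]
  (P : CuntzAlgebra n →⋆ₐ[ℂ] (H →L[ℂ] H))

/-- The vector state of a unit vector. -/
def vectorState (v : H) (hv : ‖v‖ = 1) : State (CuntzAlgebra n) :=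
  ⟨PositiveLinearMap.mk₀
    { toFun := fun a => inner ℂ v (P a v)
      map_add' := fun a b => by
        rw [map_add]; exact inner_add_right _ _ _
      map_smul' := fun z a => by
        rw [map_smul]; exact inner_smul_right _ _ _ }
    (fun a ha => by
      obtain ⟨b, rfl⟩ := CStarAlgebra.nonneg_iff_eq_star_mul_self.1 ha
      change 0 ≤ (inner ℂ v (P (star b * b) v) : ℂ)
      rw [rep_mul, ← inner_rep_left, inner_self_eq_norm_sq_to_K]
      rw [← RCLike.ofReal_pow]
      exact Complex.zero_le_real.2 (sq_nonneg ‖P b v‖)),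
    by
      change (inner ℂ v (P 1 v) : ℂ) = 1
      rw [rep_one, inner_self_eq_norm_sq_to_K, hv]; simp⟩

theorem isVectorState_vectorState (v : H) (hv : ‖v‖ = 1) :
    IsVectorState P v (vectorState P v hv) := fun _ => rfl

end Vector

variable (ω : State (CuntzAlgebra n))

theorem gns_apply_coe (a : CuntzAlgebra n) (b : ω.1.PreGNS) :
    ω.1.gnsStarAlgHom a (b : ω.1.GNS) = (ω.1.toPreGNS (a * ω.1.ofPreGNS b) : ω.1.PreGNS) :=
  ω.1.gnsNonUnitalStarAlgHom_apply_coe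

theorem gns_apply_gnsVector (a : CuntzAlgebra n) :
    ω.1.gnsStarAlgHom a (gnsVector ω) = (ω.1.toPreGNS a : ω.1.PreGNS) := by
  rw [gnsVector, gns_apply_coe, PositiveLinearMap.ofPreGNS_toPreGNS, mul_one]

theorem isVectorState_gnsVector : IsVectorState ω.1.gnsStarAlgHom (gnsVector ω) ω := by
  intro a
  rw [gns_apply_gnsVector, gnsVector, UniformSpace.Completion.inner_coe,
    PositiveLinearMap.preGNS_inner_def]
  simp

section Vector

variable {H : Type*} [NormedAddCommGroup H] [InnerProductSpace ℂ H] [CompleteSpace H]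
  {P : CuntzAlgebra n →⋆ₐ[ℂ] (H →L[ℂ] H)} {v : H} {ω : State (CuntzAlgebra n)}

theorem IsVectorState.norm_sq_apply (h : IsVectorState P v ω) (a : CuntzAlgebra n) :
    ω.1 (star a * a) = (‖P a v‖ : ℂ) ^ 2 := by
  rw [h, rep_mul, ← inner_rep_left, inner_self_eq_norm_sq_to_K]
  rfl

theorem IsVectorState.norm_eq_one (h : IsVectorState P v ω) : ‖v‖ = 1 := by
  have := h.norm_sq_apply 1
  rw [star_one, one_mul, ω.2, rep_one] at this
  have h1 : ‖v‖ ^ 2 = 1 := by exact_mod_cast this.symm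
  nlinarith [norm_nonneg v]

theorem norm_gnsVector (ω : State (CuntzAlgebra n)) : ‖gnsVector ω‖ = 1 :=
  (isVectorState_gnsVector ω).norm_eq_one

/-- The GNS representation of a vector state is a subrepresentation. -/
theorem IsVectorState.exists_intertwiner (h : IsVectorState P v ω) :
    ∃ V : ω.1.GNS →ₗᵢ[ℂ] H, (∀ a w, V (ω.1.gnsStarAlgHom a w) = P a (V w)) ∧
      V (gnsVector ω) = v := by
  -- The map `b ↦ P(b) v` is isometric on the pre-GNS space, so it extends to the completion.
  have hn : ∀ b : ω.1.PreGNS, ‖P (ω.1.ofPreGNS b) v‖ = ‖b‖ := fun b => by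
    rw [← sq_eq_sq₀ (norm_nonneg _) (norm_nonneg _)]
    have h1 := ω.1.preGNS_norm_sq b
    rw [h.norm_sq_apply] at h1
    exact_mod_cast h1.symm
  let f₀ : ω.1.PreGNS →ₗ[ℂ] H :=
    { toFun := fun b => P (ω.1.ofPreGNS b) v
      map_add' := fun a b => by rw [map_add, map_add]; rfl
      map_smul' := fun z a => by rw [map_smul, map_smul]; rfl }
  let f : ω.1.PreGNS →L[ℂ] H := f₀.mkContinuous 1 fun b => by rw [one_mul]; exact (hn b).le
  let e : ω.1.PreGNS →L[ℂ] ω.1.GNS := UniformSpace.Completion.toComplL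
  let g : ω.1.GNS →L[ℂ] H := f.extend e
  have hg : ∀ b : ω.1.PreGNS, g (b : ω.1.GNS) = P (ω.1.ofPreGNS b) v := fun b =>
    f.extend_eq UniformSpace.Completion.denseRange_coe
      (UniformSpace.Completion.isUniformInducing_coe _) b
  refine ⟨⟨g, fun w => ?_⟩, fun a w => ?_, ?_⟩
  · induction w using UniformSpace.Completion.induction_on with
    | hp => exact isClosed_eq (by fun_prop) (by fun_prop)
    | ih b =>
      rw [UniformSpace.Completion.norm_coe]
      exact (congrArg norm (hg b)).trans (hn b)
  · induction w using UniformSpace.Completion.induction_on with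
    | hp => exact isClosed_eq (by fun_prop) (by fun_prop)
    | ih b =>
      rw [gns_apply_coe]
      refine (hg _).trans ((?_ : _ = P a (P (ω.1.ofPreGNS b) v)).trans
        (congrArg (P a) (hg b).symm))
      rw [← rep_mul, PositiveLinearMap.ofPreGNS_toPreGNS]
  · refine (hg _).trans ?_
    rw [PositiveLinearMap.ofPreGNS_toPreGNS, rep_one]

theorem Equivalent.refl (ω : State (CuntzAlgebra n)) : Equivalent ω ω :=
  ⟨LinearIsometryEquiv.refl ℂ _, fun _ _ => rfl⟩

/-- If `ω` is the vector state of `v`, then a state equivalent to `ω` is the vector state of some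
vector in each closed invariant subspace that contains `v`. -/
theorem IsVectorState.of_equivalent {ω' : State (CuntzAlgebra n)} (h : IsVectorState P v ω)
    (he : Equivalent ω' ω) {M : Submodule ℂ H} (hM : IsClosed (M : Set H))
    (hPM : ∀ a, P a v ∈ M) :
    ∃ w ∈ M, IsVectorState P w ω' := by
  obtain ⟨V, hV, hVv⟩ := h.exists_intertwiner
  obtain ⟨U, hU⟩ := he
  refine ⟨V (U (gnsVector ω')), ?_, fun a => ?_⟩
  · generalize U (gnsVector ω') = x
    induction x using UniformSpace.Completion.induction_on with
    | hp => exact hM.preimage V.continuous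
    | ih b =>
      have : V (ω.1.gnsStarAlgHom (ω.1.ofPreGNS b) (gnsVector ω)) ∈ M := by
        rw [hV, hVv]; exact hPM _
      rwa [gns_apply_gnsVector] at this
  · rw [← hV, ← hU, V.inner_map_map, U.inner_map_map]
    exact isVectorState_gnsVector ω' a

/-! ### The invariant of a vector state -/

/-- The linear span of the vectors `s_J^* v`. -/
def corrSpan (P : CuntzAlgebra n →⋆ₐ[ℂ] (H →L[ℂ] H)) (v : H) : Submodule ℂ H :=
  Submodule.span ℂ (Set.range fun J : List (Idx n) => P (star (word J)) v)

theorem corrSpace_eq (ω : State (CuntzAlgebra n)) :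
    corrSpace ω = (corrSpan ω.1.gnsStarAlgHom (gnsVector ω)).topologicalClosure := by
  simp only [corrSpace, corrSpan, map_star, ContinuousLinearMap.star_eq_adjoint]

/-- The GNS intertwiner maps the span of the `s_J^* Ω` onto that of the `s_J^* v`, so independent
vectors can be pulled back. This bounds `cdim` below inside any representation that realizes the
state. -/
theorem IsVectorState.le_cdim (h : IsVectorState P v ω) {N : ℕ} {f : Fin N → H}
    (hf : ∀ j, f j ∈ corrSpan P v) (hli : LinearIndependent ℂ f) : (N : ℕ∞) ≤ cdim ω := by
  obtain ⟨V, hV, hVv⟩ := h.exists_intertwiner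
  have hmap : corrSpan P v =
      (corrSpan ω.1.gnsStarAlgHom (gnsVector ω)).map V.toLinearMap := by
    rw [corrSpan, corrSpan, Submodule.map_span, ← Set.range_comp]
    congr 2
    ext1 J
    exact (((hV _ _).trans (by rw [hVv]))).symm
  have hf' : ∀ j, ∃ x ∈ corrSpan ω.1.gnsStarAlgHom (gnsVector ω), V x = f j := fun j => by
    have := hf j
    rw [hmap] at this
    exact this
  choose x hx hxf using hf'
  let x' : Fin N → corrSpace ω := fun j =>
    ⟨x j, by rw [corrSpace_eq]; exact Submodule.le_topologicalClosure _ (hx j)⟩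
  have hx' : LinearIndependent ℂ x' := by
    refine LinearIndependent.of_comp (V.toLinearMap ∘ₗ (corrSpace ω).subtype) ?_
    convert hli using 1
    ext1 j
    exact hxf j
  have := hx'.cardinal_lift_le_rank
  rw [cdim]
  have h2 := Cardinal.toENat.monotone' this
  simpa using h2

/-- A finite-dimensional span is closed, so it also absorbs the closure in the definition of `𝒦(ω)`.
-/
theorem IsVectorState.cdim_le (h : IsVectorState P v ω) {d : ℕ} {f : Fin d → H}
    (hf : ∀ J : List (Idx n), P (star (word J)) v ∈ Submodule.span ℂ (Set.range f)) :
    cdim ω ≤ d := by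
  obtain ⟨V, hV, hVv⟩ := h.exists_intertwiner
  set F := Submodule.span ℂ (Set.range f) with hF
  have hfin : FiniteDimensional ℂ F := FiniteDimensional.span_of_finite ℂ (Set.finite_range f)
  have hle : corrSpace ω ≤ F.comap V.toLinearMap := by
    rw [corrSpace_eq]
    refine Submodule.topologicalClosure_minimal _ (Submodule.span_le.2 ?_)
      (F.closed_of_finiteDimensional.preimage V.continuous)
    rintro _ ⟨J, rfl⟩
    change V _ ∈ F
    rw [hV, hVv]
    exact hf J
  let L : corrSpace ω →ₗ[ℂ] F := V.toLinearMap.restrict hle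
  have hL : Function.Injective L := fun a b hab =>
    Subtype.ext (V.injective (congrArg Subtype.val hab))
  have h1 := LinearMap.lift_rank_le_of_injective L hL
  have h2 : Module.rank ℂ F ≤ d := (rank_span_le _).trans (by
    simpa using Cardinal.mk_range_le_lift (f := f))
  have h3 := Cardinal.toENat.monotone' (h1.trans (Cardinal.lift_le.2 h2))
  rw [cdim]
  simpa using h3

/-- A state of correlation dimension at most `d` is minimal with invariant `d` if no equivalent
state has smaller correlation dimension. -/
theorem isMinimal_and_kappa_eq {ω : State (CuntzAlgebra n)} {d : ℕ∞} (hle : cdim ω ≤ d)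
    (hge : ∀ ω', Equivalent ω' ω → d ≤ cdim ω') : IsMinimal ω ∧ kappa ω = d := by
  have h1 : kappa ω = d := by
    have h0 : kappa ω ≤ cdim ω := sInf_le ⟨ω, Equivalent.refl ω, rfl⟩
    refine le_antisymm (h0.trans hle) (le_sInf ?_)
    rintro _ ⟨ω', he, rfl⟩
    exact hge ω' he
  exact ⟨(le_antisymm hle (hge ω (Equivalent.refl ω)) : cdim ω = d).trans h1.symm, h1⟩

end Vector

end

section

variable {n : ℕ∞}

/-! ### Concatenation and tails -/

@[simp] theorem cons_zero (i : Idx n) (x : Seq n) : cons i x 0 = i := rfl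

@[simp] theorem shift_cons_one (i : Idx n) (x : Seq n) : shift (cons i x) 1 = x := rfl

theorem cons_shift (z : Seq n) : cons (z 0) (shift z 1) = z := by
  ext1 k
  cases k <;> rfl

theorem cons_eq_iff {i : Idx n} {x z : Seq n} : cons i x = z ↔ z 0 = i ∧ x = shift z 1 := by
  constructor
  · rintro rfl
    exact ⟨rfl, rfl⟩
  · rintro ⟨rfl, rfl⟩
    exact cons_shift z

theorem cons_injective (i : Idx n) : Function.Injective (cons i) := fun x y h => by
  rw [← shift_cons_one i x, h, shift_cons_one]

/-- The concatenation of a word and a sequence. -/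
def append (A : List (Idx n)) (x : Seq n) : Seq n := A.foldr cons x

@[simp] theorem append_nil (x : Seq n) : append [] x = x := rfl

@[simp] theorem append_cons (i : Idx n) (A : List (Idx n)) (x : Seq n) :
    append (i :: A) x = cons i (append A x) := rfl

theorem append_eq_iff {A : List (Idx n)} {x z : Seq n} :
    append A x = z ↔ A = initial z A.length ∧ x = shift z A.length := by
  induction A generalizing z with
  | nil => simp
  | cons i A ih =>
    rw [append_cons, cons_eq_iff, ih, List.length_cons, initial_succ_eq_cons, shift_shift,
      add_comm 1, List.cons.injEq, eq_comm (a := i), and_assoc]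

theorem append_initial (z : Seq n) (k : ℕ) : append (initial z k) (shift z k) = z :=
  append_eq_iff.2 (by simp)

theorem shift_append (A : List (Idx n)) (x : Seq n) : shift (append A x) A.length = x :=
  ((append_eq_iff (A := A) (x := x)).1 rfl).2.symm

theorem exists_initial_ne {x y : Seq n} (h : x ≠ y) : ∃ k, initial x k ≠ initial y k := by
  obtain ⟨k, hk⟩ := Function.ne_iff.1 h
  refine ⟨k + 1, fun he => hk ?_⟩
  rw [initial_succ, initial_succ] at he
  simpa using (List.append_inj' he rfl).2

theorem take_initial (x : Seq n) {k l : ℕ} (h : k ≤ l) : (initial x l).take k = initial x k :=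
  List.ext_getElem (by simpa using h) fun _ _ _ => by simp [initial]

theorem tailEquiv_iff {x y : Seq n} : TailEquiv x y ↔ ∃ p q, shift x p = shift y q := by
  simp only [TailEquiv, shift, funext_iff]

theorem TailEquiv.refl (x : Seq n) : TailEquiv x x := ⟨0, 0, fun _ => rfl⟩

theorem TailEquiv.symm {x y : Seq n} (h : TailEquiv x y) : TailEquiv y x := by
  obtain ⟨p, q, h⟩ := h
  exact ⟨q, p, fun k => (h k).symm⟩

theorem TailEquiv.trans {x y z : Seq n} (h : TailEquiv x y) (h' : TailEquiv y z) :
    TailEquiv x z := by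
  obtain ⟨p, q, h⟩ := h
  obtain ⟨r, s, h'⟩ := h'
  refine ⟨r + p, s + q, fun k => ?_⟩
  rw [← add_assoc, h, add_right_comm, h', add_right_comm, add_assoc]

theorem tailEquiv_shift (x : Seq n) (k : ℕ) : TailEquiv (shift x k) x :=
  tailEquiv_iff.2 ⟨0, k, rfl⟩

theorem tailEquiv_append (A : List (Idx n)) (x : Seq n) : TailEquiv (append A x) x :=
  tailEquiv_iff.2 ⟨A.length, 0, shift_append A x⟩

/-! ### The basis of `ℓ²(Λ)` -/

open Classical in
theorem basisVec_apply (x z : Seq n) : basisVec x z = if z = x then (1 : ℂ) else 0 := by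
  rw [basisVec, lp.single_apply, Pi.single_apply]

open Classical in
theorem norm_basisVec (x : Seq n) : ‖basisVec x‖ = 1 := by
  rw [basisVec, lp.norm_single (by norm_num), norm_one]

open Classical in
theorem inner_basisVec_left (x : Seq n) (f : SeqSpace n) : inner ℂ (basisVec x) f = f x := by
  rw [basisVec, lp.inner_single_left]
  simp

/-! ### Vectors supported in a tail class -/

/-- The vectors supported in the tail class of `y`. -/
def tailSubspace (y : Seq n) : Submodule ℂ (SeqSpace n) :=
  ⨅ z : {z : Seq n // ¬ TailEquiv z y}, LinearMap.ker (innerSL ℂ (basisVec z.1)).toLinearMap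

theorem mem_tailSubspace {y : Seq n} {f : SeqSpace n} :
    f ∈ tailSubspace y ↔ ∀ z, ¬ TailEquiv z y → f z = 0 := by
  simp [tailSubspace, Submodule.mem_iInf, inner_basisVec_left]

theorem isClosed_tailSubspace (y : Seq n) : IsClosed (tailSubspace y : Set (SeqSpace n)) := by
  rw [tailSubspace, Submodule.coe_iInf]
  exact isClosed_iInter fun z => (innerSL ℂ (basisVec z.1)).isClosed_ker

theorem basisVec_mem_tailSubspace {x y : Seq n} (h : TailEquiv x y) :
    basisVec x ∈ tailSubspace y := by
  refine mem_tailSubspace.2 fun z hz => ?_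
  rw [basisVec_apply, if_neg]
  rintro rfl
  exact hz h

/-! ### Weighted shift representations -/

/-- The operator `f ↦ f(i ·)` on `ℓ²(Λ)`. -/
def consPullback (i : Idx n) : SeqSpace n →L[ℂ] SeqSpace n :=
  have hs : ∀ f : SeqSpace n, Summable fun x => ‖f x‖ ^ (2 : ℝ≥0∞).toReal := fun f =>
    (memℓp_gen_iff (by norm_num)).1 (lp.memℓp f)
  have hm : ∀ f : SeqSpace n, Memℓp (fun x => f (cons i x)) 2 := fun f =>
    (memℓp_gen_iff (by norm_num)).2 ((hs f).comp_injective (cons_injective i))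
  LinearMap.mkContinuous
    { toFun := fun f => ⟨fun x => f (cons i x), hm f⟩
      map_add' := fun _ _ => rfl
      map_smul' := fun _ _ => rfl } 1 fun f => by
    rw [one_mul]
    refine lp.norm_le_of_tsum_le (by norm_num) (norm_nonneg f) ?_
    rw [lp.norm_rpow_eq_tsum (by norm_num)]
    exact tsum_comp_le_tsum_of_inj (hs f) (fun _ => by positivity) (cons_injective i)

theorem consPullback_apply (i : Idx n) (f : SeqSpace n) (x : Seq n) :
    consPullback i f x = f (cons i x) := rfl

/-- The coefficient at `z` is an inner product with `e_z`, and the pullback sends `e_z` to the basis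
vector of its tail if `z` starts with `i`, and to zero otherwise. -/
theorem adjoint_consPullback_apply (i : Idx n) (f : SeqSpace n) (z : Seq n) :
    ContinuousLinearMap.adjoint (consPullback i) f z = if z 0 = i then f (shift z 1) else 0 := by
  have h : consPullback i (basisVec z) = if z 0 = i then basisVec (shift z 1) else 0 := by
    ext x
    rw [consPullback_apply, basisVec_apply]
    split_ifs with h1 h2 h2
    · rw [basisVec_apply, if_pos (cons_eq_iff.1 h1).2]
    · exact absurd (cons_eq_iff.1 h1).1 h2
    · rw [basisVec_apply, if_neg fun h3 => h1 (cons_eq_iff.2 ⟨h2, h3⟩)]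
    · rfl
  rw [← inner_basisVec_left, ContinuousLinearMap.adjoint_inner_right, h]
  split_ifs
  · rw [inner_basisVec_left]
  · exact inner_zero_left _

/-- The operator on `ℓ²(Λ)` with `e_x ↦ w_i e_{ix}`. -/
def weightedShift (w : Idx n → Circle) (i : Idx n) : SeqSpace n →L[ℂ] SeqSpace n :=
  (w i : ℂ) • ContinuousLinearMap.adjoint (consPullback i)

theorem weightedShift_apply (w : Idx n → Circle) (i : Idx n) (f : SeqSpace n) (z : Seq n) :
    weightedShift w i f z = if z 0 = i then (w i : ℂ) * f (shift z 1) else 0 := by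
  refine (congrArg ((w i : ℂ) * ·) (adjoint_consPullback_apply i f z)).trans ?_
  simp only [mul_ite, mul_zero]

theorem star_weightedShift_apply (w : Idx n → Circle) (i : Idx n) (f : SeqSpace n) (x : Seq n) :
    (star (weightedShift w i)) f x = star (w i : ℂ) * f (cons i x) := by
  rw [weightedShift, star_smul, ContinuousLinearMap.star_eq_adjoint,
    ContinuousLinearMap.adjoint_adjoint]
  rfl

theorem star_coe_circle_mul (c : Circle) : star (c : ℂ) * c = 1 := by
  rw [Complex.star_def, ← Complex.normSq_eq_conj_mul_self, Circle.normSq_coe, Complex.ofReal_one]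

theorem coe_circle_mul_star (c : Circle) : (c : ℂ) * star (c : ℂ) = 1 := by
  rw [mul_comm, star_coe_circle_mul]

/-- The product `s_i s_i^*` is multiplication by the indicator of the sequences that start with `i`.
These sets partition `Λ`, and the weights cancel. -/
theorem isCuntzFamily_weightedShift (w : Idx n → Circle) : IsCuntzFamily (weightedShift w) := by
  have h₁ : ∀ i, star (weightedShift w i) * weightedShift w i = 1 := fun i => by
    ext f x
    change (star (weightedShift w i)) (weightedShift w i f) x = f x
    rw [star_weightedShift_apply, weightedShift_apply, if_pos (cons_zero i x), ← mul_assoc,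
      star_coe_circle_mul, one_mul, shift_cons_one]
  have h₂ : ∀ i j, i ≠ j → star (weightedShift w i) * weightedShift w j = 0 := fun i j hij => by
    ext f x
    change (star (weightedShift w i)) (weightedShift w j f) x = 0
    rw [star_weightedShift_apply, weightedShift_apply, if_neg (by simpa using hij), mul_zero]
  refine ⟨h₁, h₂, fun hn => ?_, fun _ F => exists_one_sub_sum_eq h₁ h₂ F⟩
  lift n to ℕ using hn
  have : Finite (Idx n) :=
    Finite.of_injective (β := Fin n) (fun i => ⟨i.1, by exact_mod_cast i.2⟩) fun i j h =>
      Subtype.ext (by simpa using h)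
  have := Fintype.ofFinite (Idx n)
  rw [finsum_eq_sum_of_fintype]
  ext f z
  have h : ∀ i, (weightedShift w i * star (weightedShift w i)) f z
      = if z 0 = i then f z else 0 := fun i => by
    change weightedShift w i ((star (weightedShift w i)) f) z = _
    rw [weightedShift_apply, star_weightedShift_apply, ← mul_assoc, coe_circle_mul_star, one_mul]
    split_ifs with hz
    · rw [← hz, cons_shift]
    · rfl
  rw [_root_.sum_apply, lp.coeFn_sum, Finset.sum_apply, Finset.sum_congr rfl
    fun i _ => h i, Finset.sum_ite_eq, if_pos (Finset.mem_univ _)]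
  rfl

/-- The product of the weights of the letters of a word. -/
def weight (w : Idx n → Circle) (A : List (Idx n)) : Circle := (A.map w).prod

theorem weight_cons (w : Idx n → Circle) (i : Idx n) (A : List (Idx n)) :
    weight w (i :: A) = w i * weight w A := by simp [weight]

variable [Nonempty (Idx n)]

/-- The universal property of `O_n` is about nonzero algebras. -/
instance : Nontrivial (SeqSpace n →L[ℂ] SeqSpace n) := by
  obtain ⟨i⟩ := ‹Nonempty (Idx n)›
  refine ⟨⟨1, 0, fun h => ?_⟩⟩
  have h1 : basisVec (fun _ => i) = 0 := congrArg (· (basisVec fun _ => i)) h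
  have h2 := norm_basisVec fun _ : ℕ => i
  rw [h1, norm_zero] at h2
  exact zero_ne_one h2

/-- The representation of `O_n` on `ℓ²(Λ)` with `s_i e_x = w_i e_{ix}`. -/
def shiftRep (w : Idx n → Circle) : CuntzAlgebra n →⋆ₐ[ℂ] (SeqSpace n →L[ℂ] SeqSpace n) :=
  (existsUnique_hom (weightedShift w) (isCuntzFamily_weightedShift w)).choose

theorem shiftRep_gen (w : Idx n → Circle) (i : Idx n) : shiftRep w (gen i) = weightedShift w i :=
  (existsUnique_hom (weightedShift w) (isCuntzFamily_weightedShift w)).choose_spec.1 i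

theorem shiftRep_star_word_apply (w : Idx n → Circle) (A : List (Idx n)) (f : SeqSpace n)
    (x : Seq n) : shiftRep w (star (word A)) f x = star (weight w A : ℂ) * f (append A x) := by
  induction A generalizing f with
  | nil => simp [weight]
  | cons i A ih =>
    rw [word_cons, star_mul, rep_mul, ih, map_star, shiftRep_gen, star_weightedShift_apply,
      weight_cons, append_cons, Circle.coe_mul, star_mul, mul_assoc]

theorem shiftRep_gen_basisVec (w : Idx n → Circle) (i : Idx n) (x : Seq n) :
    shiftRep w (gen i) (basisVec x) = (w i : ℂ) • basisVec (cons i x) := by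
  ext z
  rw [shiftRep_gen, weightedShift_apply, basisVec_apply, lp.coeFn_smul, Pi.smul_apply,
    basisVec_apply, smul_eq_mul]
  by_cases hz : z = cons i x
  · obtain ⟨h1, h2⟩ := cons_eq_iff.1 hz.symm
    rw [if_pos h1, if_pos h2.symm, if_pos hz]
  · rw [if_neg hz, mul_zero]
    split_ifs with h1 h2
    · exact absurd (cons_eq_iff.2 ⟨h1, h2.symm⟩).symm hz
    · rw [mul_zero]
    · rfl

theorem shiftRep_word_basisVec (w : Idx n → Circle) (A : List (Idx n)) (x : Seq n) :
    shiftRep w (word A) (basisVec x) = (weight w A : ℂ) • basisVec (append A x) := by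
  induction A with
  | nil => simp [weight]
  | cons i A ih =>
    rw [word_cons, rep_mul, ih, map_smul, shiftRep_gen_basisVec, smul_smul, mul_comm,
      weight_cons, append_cons, Circle.coe_mul]

theorem shiftRep_star_word_basisVec (w : Idx n → Circle) (A : List (Idx n)) (y : Seq n) :
    shiftRep w (star (word A)) (basisVec y) =
      if A = initial y A.length then star (weight w A : ℂ) • basisVec (shift y A.length)
      else 0 := by
  ext x
  rw [shiftRep_star_word_apply, basisVec_apply]
  split_ifs with h1 h2 h2
  · rw [lp.coeFn_smul, Pi.smul_apply, basisVec_apply, if_pos (append_eq_iff.1 h1).2, smul_eq_mul]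
  · exact absurd (append_eq_iff.1 h1).1 h2
  · rw [lp.coeFn_smul, Pi.smul_apply, basisVec_apply,
      if_neg fun h3 => h1 (append_eq_iff.2 ⟨h2, h3⟩), smul_eq_mul]
  · rw [mul_zero]; rfl

theorem shiftRep_star_initial_basisVec (w : Idx n → Circle) (y : Seq n) (k : ℕ) :
    shiftRep w (star (word (initial y k))) (basisVec y) =
      star (weight w (initial y k) : ℂ) • basisVec (shift y k) := by
  rw [shiftRep_star_word_basisVec, length_initial, if_pos rfl]

theorem norm_shiftRep_star_initial_basisVec (w : Idx n → Circle) (y : Seq n) (k : ℕ) :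
    ‖shiftRep w (star (word (initial y k))) (basisVec y)‖ = 1 := by
  rw [shiftRep_star_initial_basisVec, norm_smul, norm_star, Circle.norm_coe, norm_basisVec,
    mul_one]

theorem isShiftRepresentation_shiftRep_one : IsShiftRepresentation (shiftRep (n := n) 1) := by
  intro i x
  simpa using shiftRep_gen_basisVec 1 i x

/-- A vector in the ranges of all `s_K`, `K` an initial word of `y`, is a multiple of `e_y`. -/
theorem eq_smul_basisVec {w : Idx n → Circle} {v : SeqSpace n} {y : Seq n}
    (h : ∀ k, ‖shiftRep w (star (word (initial y k))) v‖ = ‖v‖) : v = v y • basisVec y := by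
  have hu := isOrbit_of_norm_eq h
  ext z
  rw [lp.coeFn_smul, Pi.smul_apply, basisVec_apply]
  split_ifs with hz
  · rw [hz, smul_eq_mul, mul_one]
  -- The word `K = initial z k` is not initial in `y`, so `s_K^* v = 0`. The coefficient of `s_K^*
  -- v` at the tail of `z` is `v z` up to a unimodular factor.
  obtain ⟨k, hk⟩ := exists_initial_ne hz
  have h1 := hu.star_word (initial z k) 0
  rw [if_neg (by simpa using hk)] at h1
  have h2 := congrArg (fun f : SeqSpace n => f (shift z k)) h1
  simp only [initial_zero, word_nil, star_one, rep_one] at h2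
  rw [shiftRep_star_word_apply, append_initial] at h2
  rw [smul_zero]
  refine (mul_eq_zero.1 (h2.trans rfl)).resolve_left ?_
  exact star_ne_zero.2 (Circle.coe_ne_zero _)

/-- It suffices to test `s_A s_B^*`: it removes an initial word of `y` and prepends another, or
gives zero. -/
theorem shiftRep_basisVec_mem_tailSubspace (w : Idx n → Circle) (y : Seq n)
    (a : CuntzAlgebra n) : shiftRep w a (basisVec y) ∈ tailSubspace y := by
  refine mem_of_word_mul_star_word
    (M := (tailSubspace y).comap (repApply (shiftRep w) (basisVec y)).toLinearMap)
    ((isClosed_tailSubspace y).preimage (repApply (shiftRep w) (basisVec y)).continuous)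
    (fun A B => ?_) a
  change shiftRep w (word A * star (word B)) (basisVec y) ∈ tailSubspace y
  rw [rep_mul, shiftRep_star_word_basisVec]
  split_ifs
  · rw [map_smul, shiftRep_word_basisVec]
    exact Submodule.smul_mem _ _ (Submodule.smul_mem _ _ (basisVec_mem_tailSubspace
      ((tailEquiv_append _ _).trans (tailEquiv_shift _ _))))
  · rw [map_zero]; exact zero_mem _

/-! ### Asymptotics of `s_K^* v` -/

open Classical in
theorem tendsto_shiftRep_star_initial (w : Idx n → Circle) (y : Seq n) (v : SeqSpace n) :
    Filter.Tendsto (fun k => shiftRep w (star (word (initial y k))) v -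
      (star (weight w (initial y k) : ℂ) * v y) • basisVec (shift y k))
      Filter.atTop (nhds 0) := by
  -- The differences are linear in `v` and bounded by 2 uniformly in `k`. So the vectors on which
  -- they tend to zero form a closed subspace, and basis vectors suffice: `D k` kills `e_y`, and it
  -- kills `e_z` once `k` is past a disagreement of `z` and `y`.
  let D : ℕ → SeqSpace n →L[ℂ] SeqSpace n := fun k =>
    shiftRep w (star (word (initial y k))) -
      star (weight w (initial y k) : ℂ) • (innerSL ℂ (basisVec y)).smulRight (basisVec (shift y k))
  have hD : ∀ k f, D k f = shiftRep w (star (word (initial y k))) f -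
      (star (weight w (initial y k) : ℂ) * f y) • basisVec (shift y k) := fun k f => by
    rw [mul_smul, ← inner_basisVec_left]
    rfl
  have hDle : ∀ k f, ‖D k f‖ ≤ 2 * ‖f‖ := fun k f => by
    rw [hD]
    refine (norm_sub_le _ _).trans ?_
    rw [norm_smul, norm_mul, norm_star, Circle.norm_coe, norm_basisVec, one_mul, mul_one,
      ← inner_basisVec_left]
    have h1 := norm_rep_star_word_le (shiftRep w) (initial y k) f
    have h2 := norm_inner_le_norm (𝕜 := ℂ) (basisVec y) f
    rw [norm_basisVec, one_mul] at h2
    linarith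
  let M : Submodule ℂ (SeqSpace n) :=
    { carrier := {f | Filter.Tendsto (fun k => D k f) Filter.atTop (nhds 0)}
      add_mem' := fun {f g} hf hg => by
        simpa only [Set.mem_ofPred_eq, map_add, add_zero] using Filter.Tendsto.add hf hg
      zero_mem' := by
        simp only [Set.mem_ofPred_eq, map_zero]
        exact tendsto_const_nhds
      smul_mem' := fun c f hf => by
        simpa only [Set.mem_ofPred_eq, map_smul, smul_zero] using Filter.Tendsto.const_smul hf c }
  have hM : IsClosed (M : Set (SeqSpace n)) := by
    refine isClosed_of_closure_subset fun f hf => ?_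
    refine Metric.tendsto_atTop.2 fun ε hε => ?_
    -- With the bound 2, an error `ε / 4` in the vector costs at most `ε / 2`.
    obtain ⟨g, hg, hfg⟩ := Metric.mem_closure_iff.1 hf (ε / 4) (by positivity)
    obtain ⟨N, hN⟩ := Metric.tendsto_atTop.1 hg (ε / 2) (by positivity)
    refine ⟨N, fun k hk => ?_⟩
    have h1 := hN k hk
    have h2 := hDle k (f - g)
    rw [dist_zero_right] at h1 ⊢
    rw [dist_eq_norm] at hfg
    have h3 : D k f = D k (f - g) + D k g := by rw [map_sub, sub_add_cancel]
    rw [h3]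
    refine (norm_add_le _ _).trans_lt ?_
    linarith
  have hb : ∀ z, basisVec z ∈ M := fun z => by
    by_cases hz : z = y
    · subst hz
      refine tendsto_const_nhds.congr fun k => ?_
      rw [hD, shiftRep_star_initial_basisVec, basisVec_apply, if_pos rfl, mul_one, sub_self]
    · obtain ⟨N, hN⟩ := exists_initial_ne hz
      refine tendsto_const_nhds.congr' ?_
      filter_upwards [Filter.eventually_ge_atTop N] with k hk
      rw [hD, shiftRep_star_word_basisVec, if_neg, basisVec_apply, if_neg (Ne.symm hz), mul_zero,
        zero_smul, sub_zero]
      rw [length_initial]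
      refine fun he => hN ?_
      rw [← take_initial z hk, ← take_initial y hk, he]
  have hv : v ∈ M := by
    have hs := lp.hasSum_single (p := 2) (by norm_num) v
    refine hM.mem_of_tendsto hs (Filter.Eventually.of_forall fun F => M.sum_mem fun z _ => ?_)
    have : (lp.single 2 z (v z) : SeqSpace n) = v z • basisVec z := by
      rw [basisVec, ← lp.single_smul, smul_eq_mul, mul_one]
    rw [this]
    exact M.smul_mem _ (hb z)
  exact (show Filter.Tendsto (fun k => D k v) _ _ from hv).congr fun k => hD k v

/-- If `v` has a nonzero coefficient at `y`, then the vectors `s_J^* v` span a space whose dimension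
is at least the number of consecutive tails of `y` that are always distinct. -/
theorem exists_linearIndependent_corrSpan (w : Idx n → Circle) {y : Seq n} {v : SeqSpace n}
    (hv : v y ≠ 0) {N L₀ : ℕ}
    (hy : ∀ a, L₀ ≤ a → ∀ i j : Fin N, i ≠ j → shift y (a + i) ≠ shift y (a + j)) :
    ∃ f : Fin N → SeqSpace n, (∀ j, f j ∈ corrSpan (shiftRep w) v) ∧ LinearIndependent ℂ f := by
  have hpos : 0 < ‖v y‖ := norm_pos_iff.2 hv
  -- With entrywise error below `δ`, the off-diagonal entries of a row sum to at most `N δ = ‖v y‖ -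
  -- δ`, while the diagonal entry exceeds this: strict diagonal dominance.
  set δ := ‖v y‖ / (N + 1) with hδ
  have hδ0 : 0 < δ := by positivity
  have hδN : N * δ + δ = ‖v y‖ := by rw [hδ]; field_simp
  obtain ⟨L₁, hL₁⟩ := Metric.tendsto_atTop.1 (tendsto_shiftRep_star_initial w y v) δ hδ0
  set L := max L₀ L₁ with hL
  refine ⟨fun j => shiftRep w (star (word (initial y (L + j)))) v,
    fun j => Submodule.subset_span ⟨_, rfl⟩, ?_⟩
  let E : SeqSpace n →ₗ[ℂ] (Fin N → ℂ) :=
    LinearMap.pi fun i : Fin N => (innerSL ℂ (basisVec (shift y (L + i)))).toLinearMap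
  -- Row `j` consists of the coefficients of the `j`-th vector at the `N` tails.
  let B : Matrix (Fin N) (Fin N) ℂ := Matrix.of fun j i =>
    shiftRep w (star (word (initial y (L + j)))) v (shift y (L + i))
  have hclose : ∀ j i : Fin N, ‖B j i - if i = j then
      star (weight w (initial y (L + j)) : ℂ) * v y else 0‖ < δ := by
    intro j i
    have h1 := hL₁ (L + j) ((le_max_right _ _).trans (Nat.le_add_right _ _))
    rw [dist_zero_right] at h1
    refine lt_of_le_of_lt ?_ h1
    have h2 := norm_inner_le_norm (𝕜 := ℂ) (basisVec (shift y (L + i)))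
      (shiftRep w (star (word (initial y (L + j)))) v -
      (star (weight w (initial y (L + j)) : ℂ) * v y) • basisVec (shift y (L + j)))
    rw [norm_basisVec, one_mul, inner_basisVec_left] at h2
    refine le_trans (le_of_eq (congrArg norm ?_)) h2
    rw [lp.coeFn_sub, Pi.sub_apply, lp.coeFn_smul, Pi.smul_apply, basisVec_apply, smul_eq_mul]
    congr 1
    split_ifs with hij h3 h3
    · rw [mul_one]
    · rw [hij] at h3; exact absurd rfl h3
    · exact absurd h3 (hy L (le_max_left _ _) i j hij)
    · rw [mul_zero]
  have hdet : B.det ≠ 0 := by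
    refine det_ne_zero_of_sum_row_lt_diag fun j => ?_
    have hdiag : ‖v y‖ - δ < ‖B j j‖ := by
      have h1 := hclose j j
      rw [if_pos rfl, norm_sub_rev] at h1
      have h2 := norm_sub_norm_le (star (weight w (initial y (L + j)) : ℂ) * v y) (B j j)
      rw [norm_mul, norm_star, Circle.norm_coe, one_mul] at h2
      linarith
    refine lt_of_le_of_lt ?_ hdiag
    have hoff : ∀ i ∈ Finset.univ.erase j, ‖B j i‖ ≤ δ := fun i hi => by
      have h1 := hclose j i
      rw [if_neg (Finset.ne_of_mem_erase hi), sub_zero] at h1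
      exact h1.le
    refine (Finset.sum_le_card_nsmul _ _ _ hoff).trans ?_
    have hcard : ((Finset.univ.erase j).card : ℝ) ≤ N := by
      exact_mod_cast (Finset.card_le_univ _).trans (Fintype.card_fin N).le
    rw [nsmul_eq_mul]
    nlinarith
  refine LinearIndependent.of_comp E ?_
  have he : (E ∘ fun j : Fin N => shiftRep w (star (word (initial y (L + j)))) v) = B.row := by
    ext j i
    exact inner_basisVec_left _ _
  rw [he]
  exact Matrix.linearIndependent_rows_of_det_ne_zero hdet

end

section

variable {n : ℕ∞}

/-! ### Tails of sequences that are not eventually periodic -/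

theorem shift_ne_of_not_eventuallyPeriodic {y : Seq n} (hy : ¬ EventuallyPeriodic y) {k l : ℕ}
    (h : k ≠ l) : shift y k ≠ shift y l := by
  wlog hkl : k < l generalizing k l
  · exact (this h.symm (by omega)).symm
  refine fun he => hy ⟨k, l - k, by omega, fun i hi => ?_⟩
  have := congrFun he (i - k)
  simp only [shift] at this
  rw [show i + (l - k) = i - k + l by omega, ← this]
  congr 1
  omega

/-! ### Purity and determination by initial words -/

/-- Strict convexity of the disc, from `t|a|² + (1-t)|b|² - |c|² = t(1-t)|a-b|²`. -/
theorem eq_of_convex_combination {a b c : ℂ} {t : ℝ} (ht : 0 < t) (ht' : t < 1) (ha : ‖a‖ ≤ 1)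
    (hb : ‖b‖ ≤ 1) (hc : ‖c‖ = 1) (h : c = (t : ℂ) * a + ((1 - t : ℝ) : ℂ) * b) :
    a = c ∧ b = c := by
  have hre := congrArg Complex.re h
  have him := congrArg Complex.im h
  simp only [Complex.add_re, Complex.add_im, Complex.re_ofReal_mul, Complex.im_ofReal_mul]
    at hre him
  have sq : ∀ z : ℂ, ‖z‖ ^ 2 = z.re ^ 2 + z.im ^ 2 := fun z => by
    rw [Complex.sq_norm, Complex.normSq_apply]; ring
  have ha2 : a.re ^ 2 + a.im ^ 2 ≤ 1 := by rw [← sq]; exact pow_le_one₀ (norm_nonneg _) ha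
  have hb2 : b.re ^ 2 + b.im ^ 2 ≤ 1 := by rw [← sq]; exact pow_le_one₀ (norm_nonneg _) hb
  have hc2 : c.re ^ 2 + c.im ^ 2 = 1 := by rw [← sq, hc, one_pow]
  have hs : 0 < t * (1 - t) := mul_pos ht (by linarith)
  have key : t * (1 - t) * ((a.re - b.re) ^ 2 + (a.im - b.im) ^ 2) ≤ 0 := by
    have e : t * (1 - t) * ((a.re - b.re) ^ 2 + (a.im - b.im) ^ 2)
        = t * (a.re ^ 2 + a.im ^ 2) + (1 - t) * (b.re ^ 2 + b.im ^ 2)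
          - (c.re ^ 2 + c.im ^ 2) := by
      rw [hre, him]; ring
    rw [e, hc2]
    nlinarith
  have h0 : (a.re - b.re) ^ 2 + (a.im - b.im) ^ 2 ≤ 0 := by
    by_contra hcon
    push Not at hcon
    nlinarith [mul_pos hs hcon]
  have h1 : a.re = b.re := by nlinarith [sq_nonneg (a.re - b.re), sq_nonneg (a.im - b.im)]
  have h2 : a.im = b.im := by nlinarith [sq_nonneg (a.re - b.re), sq_nonneg (a.im - b.im)]
  have hab : a = b := Complex.ext h1 h2
  have hbc : b = c := by rw [h, hab]; push_cast; ring
  exact ⟨hab.trans hbc, hbc⟩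

/-- A state is pure if it is the only state that agrees with it on some set where its values have
the largest possible absolute value. -/
theorem isPure_of_unique {ι : Type*} {ω : State (CuntzAlgebra n)} (a : ι → CuntzAlgebra n)
    (hle : ∀ (φ : State (CuntzAlgebra n)) i, ‖φ.1 (a i)‖ ≤ 1) (hω : ∀ i, ‖ω.1 (a i)‖ = 1)
    (huniq : ∀ φ : State (CuntzAlgebra n), (∀ i, φ.1 (a i) = ω.1 (a i)) → φ = ω) : IsPure ω := by
  intro φ ψ t ht ht' h
  have key := fun i => eq_of_convex_combination ht ht' (hle φ i) (hle ψ i) (hω i) (h (a i))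
  exact ⟨huniq φ fun i => (key i).1, huniq ψ fun i => (key i).2⟩

theorem norm_state_word_le (φ : State (CuntzAlgebra n)) (A : List (Idx n)) :
    ‖φ.1 (word A)‖ ≤ 1 := by
  rw [isVectorState_gnsVector φ]
  refine (norm_inner_le_norm _ _).trans ?_
  rw [norm_rep_word, norm_gnsVector, one_mul]

theorem norm_state_word_mul_star_word_le (φ : State (CuntzAlgebra n)) (A : List (Idx n)) :
    ‖φ.1 (word A * star (word A))‖ ≤ 1 := by
  have h := (isVectorState_gnsVector φ).norm_sq_apply (star (word A))
  rw [star_star] at h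
  rw [h, norm_pow, Complex.norm_real, norm_norm]
  refine pow_le_one₀ (norm_nonneg _) ((norm_rep_star_word_le _ _ _).trans ?_)
  rw [norm_gnsVector]

section Vector

variable {H H' : Type*} [NormedAddCommGroup H] [InnerProductSpace ℂ H] [CompleteSpace H]
  [NormedAddCommGroup H'] [InnerProductSpace ℂ H'] [CompleteSpace H']
  {π : CuntzAlgebra n →⋆ₐ[ℂ] (H →L[ℂ] H)} {v : H} {φ ψ : State (CuntzAlgebra n)}
  {π' : CuntzAlgebra n →⋆ₐ[ℂ] (H' →L[ℂ] H')} {v' : H'} {y : Seq n}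

theorem IsVectorState.apply_word_mul_star_word_eq_one_iff (h : IsVectorState π v φ)
    (A : List (Idx n)) : φ.1 (word A * star (word A)) = 1 ↔ ‖π (star (word A)) v‖ = ‖v‖ := by
  have h1 := h.norm_sq_apply (star (word A))
  rw [star_star] at h1
  rw [h1, h.norm_eq_one, ← Complex.ofReal_pow, Complex.ofReal_eq_one,
    pow_eq_one_iff_of_nonneg (norm_nonneg _) two_ne_zero]

/-- Two states agree if they are concentrated on `y` and if they agree on the products `s_K s_L^*`
of initial words after which the tails of `y` are equal. -/
theorem IsVectorState.eq_of_norm_eq (h : IsVectorState π v φ) (h' : IsVectorState π' v' ψ)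
    (hv : ∀ k, ‖π (star (word (initial y k))) v‖ = ‖v‖)
    (hv' : ∀ k, ‖π' (star (word (initial y k))) v'‖ = ‖v'‖)
    (hin : ∀ k l, shift y k = shift y l →
      (inner ℂ (π (star (word (initial y k))) v) (π (star (word (initial y l))) v) : ℂ) =
        inner ℂ (π' (star (word (initial y k))) v') (π' (star (word (initial y l))) v')) :
    φ = ψ := by
  refine state_ext fun a => ?_
  have := (isOrbit_of_norm_eq hv).inner_rep_eq (isOrbit_of_norm_eq hv') hin a
  simp only [initial_zero, word_nil, star_one, rep_one] at this
  rw [h a, h' a, this]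

end Vector

/-! ### Equivalence of vector states of basis vectors -/

section Basis

variable [Nonempty (Idx n)] {w w' : Idx n → Circle} {y y' : Seq n} {ω ω' : State (CuntzAlgebra n)}

/-- The state `ω` is realized by a vector `v` in the tail class of `y'`, and its values at `s_K
s_K^*` force `v` to be a unimodular multiple of `e_y`. The weights `w` and `w'` may differ, which is
what separates the states `ρ_c` over one sequence. -/
theorem equivalent_basisVec (h : IsVectorState (shiftRep w) (basisVec y) ω)
    (h' : IsVectorState (shiftRep w') (basisVec y') ω') (he : Equivalent ω ω') :
    TailEquiv y y' ∧ (y = y' → ω = ω') := by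
  obtain ⟨v, hv, hvω⟩ := h'.of_equivalent he (isClosed_tailSubspace y')
    (shiftRep_basisVec_mem_tailSubspace w' y')
  have hv1 : v = v y • basisVec y := eq_smul_basisVec fun k => by
    rw [← hvω.apply_word_mul_star_word_eq_one_iff, h.apply_word_mul_star_word_eq_one_iff,
      norm_shiftRep_star_initial_basisVec, norm_basisVec]
  have hn1 : ‖v y‖ = 1 := by
    have := hvω.norm_eq_one
    rwa [hv1, norm_smul, norm_basisVec, mul_one] at this
  constructor
  · by_contra hne
    rw [mem_tailSubspace.1 hv y hne, norm_zero] at hn1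
    exact zero_ne_one hn1
  · rintro rfl
    refine state_ext fun a => ?_
    rw [hvω a, hv1, map_smul, inner_smul_left, inner_smul_right, ← mul_assoc, ← h' a,
      ← Complex.normSq_eq_conj_mul_self, Complex.normSq_eq_norm_sq, hn1]
    simp

theorem le_cdim_of_equivalent (h : IsVectorState (shiftRep w) (basisVec y) ω) {N : ℕ}
    (hy : ∀ (a : ℕ) (i j : Fin N), i ≠ j → shift y (a + i) ≠ shift y (a + j))
    (he : Equivalent ω' ω) : (N : ℕ∞) ≤ cdim ω' := by
  obtain ⟨v, hv, hvω⟩ := h.of_equivalent he (isClosed_tailSubspace y)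
    (shiftRep_basisVec_mem_tailSubspace w y)
  obtain ⟨z, hz⟩ : ∃ z, v z ≠ 0 := by
    by_contra hcon
    push Not at hcon
    have h0 : v = 0 := lp.ext (funext hcon)
    have := hvω.norm_eq_one
    rw [h0, norm_zero] at this
    exact zero_ne_one this
  -- The coefficient of `v` at `y` itself may vanish. Some `z` in the tail class has a nonzero one,
  -- and from position `p` on its tails are tails of `y`.
  obtain ⟨p, q, hpq⟩ := tailEquiv_iff.1 (by_contra fun hne => hz (mem_tailSubspace.1 hv z hne))
  have hs : ∀ a b, p ≤ a → shift z (a + b) = shift y (q + (a - p) + b) := fun a b ha => by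
    rw [add_assoc, ← shift_shift y, ← hpq, shift_shift]
    congr 1
    omega
  obtain ⟨f, hf, hli⟩ := exists_linearIndependent_corrSpan w (N := N) (L₀ := p) hz
    fun a ha i j hij => by
      rw [hs a i ha, hs a j ha]
      exact hy _ i j hij
  exact hvω.le_cdim hf hli

/-! ### Sequences that are not eventually periodic -/

theorem isPure_of_not_eventuallyPeriodic (hy : ¬ EventuallyPeriodic y)
    (h : IsVectorState (shiftRep w) (basisVec y) ω) : IsPure ω := by
  have hv : ∀ k, ‖shiftRep w (star (word (initial y k))) (basisVec y)‖ = ‖basisVec y‖ :=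
    fun k => by rw [norm_shiftRep_star_initial_basisVec, norm_basisVec]
  have hω : ∀ k, ω.1 (word (initial y k) * star (word (initial y k))) = 1 := fun k =>
    (h.apply_word_mul_star_word_eq_one_iff _).2 (hv k)
  refine isPure_of_unique (fun k => word (initial y k) * star (word (initial y k)))
    (fun φ k => norm_state_word_mul_star_word_le φ _) (fun k => by rw [hω, norm_one])
    fun φ hφ => ?_
  have hφ1 := isVectorState_gnsVector φ
  have hv' := fun k => (hφ1.apply_word_mul_star_word_eq_one_iff (initial y k)).1
    ((hφ k).trans (hω k))
  refine hφ1.eq_of_norm_eq h hv' hv fun k l hkl => ?_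
  -- All tails are distinct, so only norms remain to be compared.
  obtain rfl : k = l := by_contra fun hne => shift_ne_of_not_eventuallyPeriodic hy hne hkl
  rw [inner_self_eq_norm_sq_to_K, inner_self_eq_norm_sq_to_K, hv', hv, norm_gnsVector,
    norm_basisVec]

theorem isMinimal_of_not_eventuallyPeriodic (hy : ¬ EventuallyPeriodic y)
    (h : IsVectorState (shiftRep w) (basisVec y) ω) : IsMinimal ω ∧ kappa ω = ⊤ := by
  refine isMinimal_and_kappa_eq le_top fun ω' he =>
    top_le_iff.2 (ENat.eq_top_iff_forall_ge.2 fun N => ?_)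
  refine le_cdim_of_equivalent h (fun a i j hij => ?_) he
  refine shift_ne_of_not_eventuallyPeriodic hy fun hne => hij (Fin.ext ?_)
  omega

end Basis

/-! ### Periodic sequences -/

theorem initial_add (y : Seq n) (k l : ℕ) :
    initial y (k + l) = initial y k ++ initial (shift y k) l := by
  induction l with
  | zero => simp
  | succ l ih =>
    rw [← add_assoc, initial_succ, ih, initial_succ, List.append_assoc]
    congr 3
    rw [shift, add_comm]

theorem shift_mul {y : Seq n} {m : ℕ} (hy : shift y m = y) (t : ℕ) : shift y (m * t) = y := by
  induction t with
  | zero => rfl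
  | succ t ih => rw [Nat.mul_succ, ← shift_shift, ih, hy]

theorem shift_mod {y : Seq n} {m : ℕ} (hy : shift y m = y) (k : ℕ) :
    shift y (k % m) = shift y k := by
  conv_rhs => rw [← Nat.div_add_mod k m, ← shift_shift, shift_mul hy]

section Periodic

variable {y : Seq n} {m : ℕ} {c : ℂ} {φ : State (CuntzAlgebra n)}

/-- Equality case of Cauchy–Schwarz: `‖s_A^* Ω - c̄ Ω‖² ≤ 1 - 2 + 1`. -/
theorem gns_star_word_gnsVector {A : List (Idx n)} (hc : ‖c‖ = 1) (hφ : φ.1 (word A) = c) :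
    φ.1.gnsStarAlgHom (star (word A)) (gnsVector φ) = star c • gnsVector φ := by
  rw [← sub_eq_zero, ← norm_eq_zero, ← sq_eq_zero_iff]
  refine le_antisymm ?_ (sq_nonneg _)
  have h1 := norm_rep_star_word_le φ.1.gnsStarAlgHom A (gnsVector φ)
  have h2 := norm_gnsVector φ
  rw [@norm_sub_sq ℂ, inner_rep_star_left, map_smul, inner_smul_right,
    ← isVectorState_gnsVector φ, hφ, norm_smul, norm_star, hc, h2]
  have h3 : star c * c = 1 := by
    rw [Complex.star_def, ← Complex.normSq_eq_conj_mul_self, Complex.normSq_eq_norm_sq, hc]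
    simp
  rw [h3, RCLike.one_re]
  rw [h2] at h1
  nlinarith [norm_nonneg (φ.1.gnsStarAlgHom (star (word A)) (gnsVector φ))]

theorem gns_star_initial_add (hy : shift y m = y) (hc : ‖c‖ = 1)
    (hφ : φ.1 (word (initial y m)) = c) (t k : ℕ) :
    φ.1.gnsStarAlgHom (star (word (initial y (m * t + k)))) (gnsVector φ) =
      star c ^ t • φ.1.gnsStarAlgHom (star (word (initial y k))) (gnsVector φ) := by
  induction t with
  | zero => simp
  | succ t ih =>
    rw [Nat.mul_succ, add_comm (m * t) m, add_assoc, initial_add, hy, word_append, star_mul,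
      rep_mul, gns_star_word_gnsVector hc hφ, map_smul, ih, smul_smul, pow_succ']

/-- The word is a prefix of the `k`-th power of the period, whose adjoint preserves the norm of `Ω`.
Adjoints of words are contractions, so no norm can be lost on the way. -/
theorem norm_gns_star_initial (hm : 1 ≤ m) (hy : shift y m = y) (hc : ‖c‖ = 1)
    (hφ : φ.1 (word (initial y m)) = c) (k : ℕ) :
    ‖φ.1.gnsStarAlgHom (star (word (initial y k))) (gnsVector φ)‖ = ‖gnsVector φ‖ := by
  refine le_antisymm (norm_rep_star_word_le _ _ _) ?_
  have h1 := gns_star_initial_add hy hc hφ k 0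
  have hk : m * k + 0 = k + (m * k - k) := by
    have : k ≤ m * k := Nat.le_mul_of_pos_left k hm
    omega
  have h2 := congrArg norm h1
  rw [norm_smul, norm_pow, norm_star, hc, one_pow, one_mul, initial_zero, word_nil, star_one,
    rep_one, hk, initial_add, word_append, star_mul, rep_mul] at h2
  rw [← h2]
  exact norm_rep_star_word_le _ _ _

/-- If `y` has least period `m`, then a state is determined by its value at `s_K`, `K` the initial
word of `y` of length `m`, if that value has absolute value one. -/
theorem state_eq_of_period {ψ : State (CuntzAlgebra n)} (hm : 1 ≤ m) (hy : shift y m = y)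
    (hmod : ∀ k l, shift y k = shift y l → k ≡ l [MOD m]) (hc : ‖c‖ = 1)
    (hφ : φ.1 (word (initial y m)) = c) (hψ : ψ.1 (word (initial y m)) = c) : φ = ψ := by
  refine (isVectorState_gnsVector φ).eq_of_norm_eq (isVectorState_gnsVector ψ)
    (norm_gns_star_initial hm hy hc hφ) (norm_gns_star_initial hm hy hc hψ) fun k l hkl => ?_
  wlog hle : l ≤ k generalizing k l
  · have := congrArg star (this l k hkl.symm (by omega))
    rwa [Complex.star_def, inner_conj_symm, inner_conj_symm] at this
  -- Equal tails differ by `t` full periods, and each period contributes the same factor `c̄` in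
  -- both representations.
  obtain ⟨t, ht⟩ := (Nat.modEq_iff_dvd' hle).1 (hmod k l hkl).symm
  obtain rfl : k = m * t + l := by omega
  rw [gns_star_initial_add hy hc hφ, gns_star_initial_add hy hc hψ, inner_smul_left,
    inner_smul_left, inner_self_eq_norm_sq_to_K, inner_self_eq_norm_sq_to_K,
    norm_gns_star_initial hm hy hc hφ, norm_gns_star_initial hm hy hc hψ, norm_gnsVector,
    norm_gnsVector]

theorem isPure_of_period (hm : 1 ≤ m) (hy : shift y m = y)
    (hmod : ∀ k l, shift y k = shift y l → k ≡ l [MOD m]) (hc : ‖c‖ = 1)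
    (hφ : φ.1 (word (initial y m)) = c) : IsPure φ :=
  isPure_of_unique (fun _ : Unit => word (initial y m)) (fun ψ _ => norm_state_word_le ψ _)
    (fun _ => by rw [hφ, hc])
    fun ψ hψ => state_eq_of_period hm hy hmod hc ((hψ ()).trans hφ) hφ

theorem isMinimal_of_period [Nonempty (Idx n)] {w : Idx n → Circle} (hm : 1 ≤ m)
    (hy : shift y m = y) (hmod : ∀ k l, shift y k = shift y l → k ≡ l [MOD m])
    (h : IsVectorState (shiftRep w) (basisVec y) φ) : IsMinimal φ ∧ kappa φ = m := by
  refine isMinimal_and_kappa_eq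
    (h.cdim_le (f := fun j : Fin m => basisVec (shift y j)) fun J => ?_) fun ω' he => ?_
  · rw [shiftRep_star_word_basisVec]
    split_ifs
    · rw [← shift_mod hy]
      exact Submodule.smul_mem _ _ (Submodule.subset_span ⟨⟨_, Nat.mod_lt _ hm⟩, rfl⟩)
    · exact zero_mem _
  · refine le_cdim_of_equivalent h (fun a i j hij hne => hij (Fin.ext ?_)) he
    exact (Nat.ModEq.add_left_cancel' a (hmod _ _ hne)).eq_of_lt_of_lt i.2 j.2

end Periodic

/-! ### The sub-Cuntz states `ρ_c` -/

section SubCuntz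

variable (hn : 2 ≤ n) (m : ℕ)

theorem idxOne_ne_idxTwo : idxOne hn ≠ idxTwo hn := fun h => by
  simpa [idxOne, idxTwo] using congrArg Subtype.val h

/-- The periodic sequence with period `2 ⋯ 2 1` of length `m`. -/
def periodicSeq : Seq n := fun j => if m ∣ j + 1 then idxOne hn else idxTwo hn

open Classical in
/-- The weights `c, 1, 1, …`. -/
def circleWeight (c : Circle) : Idx n → Circle := fun i => if i = idxOne hn then c else 1

theorem shift_periodicSeq : shift (periodicSeq hn m) m = periodicSeq hn m := by
  ext1 j
  simp only [shift, periodicSeq]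
  simp only [add_right_comm j m 1, Nat.dvd_add_left (dvd_refl m)]

/-- The letter 1 occurs exactly at the positions `j` with `m ∣ j + 1`, so a tail reveals its
starting point modulo `m`. The position compared in the proof makes `j + k + 1` equal to `m (k +
1)`. -/
theorem modEq_of_shift_periodicSeq_eq (hm : 1 ≤ m) (k l : ℕ)
    (h : shift (periodicSeq hn m) k = shift (periodicSeq hn m) l) : k ≡ l [MOD m] := by
  have hj := congrFun h (m * (k + 1) - (k + 1))
  have hle : k + 1 ≤ m * (k + 1) := Nat.le_mul_of_pos_left _ hm
  have h1 : m ∣ m * (k + 1) - (k + 1) + k + 1 := ⟨k + 1, by omega⟩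
  simp only [shift, periodicSeq, if_pos h1] at hj
  by_cases h2 : m ∣ m * (k + 1) - (k + 1) + l + 1
  · have h3 := (Nat.modEq_zero_iff_dvd.2 h1).trans (Nat.modEq_zero_iff_dvd.2 h2).symm
    exact Nat.ModEq.add_left_cancel' _ (Nat.ModEq.add_right_cancel' 1 h3)
  · rw [if_neg h2] at hj
    exact absurd hj (idxOne_ne_idxTwo hn)

theorem periodicSeq_of_lt {k : ℕ} (hk : k < m) :
    periodicSeq hn m k = if k + 1 = m then idxOne hn else idxTwo hn := by
  rw [periodicSeq]
  congr 1
  exact propext ⟨fun h => le_antisymm hk (Nat.le_of_dvd (by omega) h), fun h => h ▸ dvd_refl _⟩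

/-- The letter 1 occurs once per period, so the weight `c` enters exactly once. -/
theorem weight_initial_periodicSeq (hm : 1 ≤ m) (c : Circle) :
    weight (circleWeight hn c) (initial (periodicSeq hn m) m) = c := by
  rw [weight, initial, List.map_ofFn, List.prod_ofFn,
    Finset.prod_eq_single (⟨m - 1, by omega⟩ : Fin m)]
  · simp only [Function.comp_apply]
    rw [periodicSeq_of_lt hn m (by omega), if_pos (by omega), circleWeight, if_pos rfl]
  · intro j _ hj
    simp only [Function.comp_apply]
    rw [periodicSeq_of_lt hn m j.2, if_neg, circleWeight, if_neg (idxOne_ne_idxTwo hn).symm]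
    exact fun h => hj (Fin.ext (by simp only; omega))
  · exact fun h => absurd (Finset.mem_univ _) h

open Classical in
theorem circleVector_apply (c : Circle) (J : Fin m → Idx n) :
    circleVector hn m c J =
      if J = fun k : Fin m => periodicSeq hn m k then star (c : ℂ) else 0 := by
  rw [circleVector, lp.single_apply, Pi.single_apply]
  congr 2
  ext1 k
  exact (periodicSeq_of_lt hn m k.2).symm

/-- The sub-Cuntz state `ρ_c`. -/
def circleState (c : Circle) : State (CuntzAlgebra n) :=
  haveI : Nonempty (Idx n) := ⟨idxOne hn⟩
  vectorState (shiftRep (circleWeight hn c)) (basisVec (periodicSeq hn m)) (norm_basisVec _)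

variable [Nonempty (Idx n)]

theorem isVectorState_circleState (c : Circle) :
    IsVectorState (shiftRep (circleWeight hn c)) (basisVec (periodicSeq hn m))
      (circleState hn m c) := fun _ => rfl

variable {m}

open Classical in
theorem circleState_word (hm : 1 ≤ m) (c : Circle) (J : Fin m → Idx n) :
    (circleState hn m c).1 (word (List.ofFn J)) =
      if J = fun k : Fin m => periodicSeq hn m k then (c : ℂ) else 0 := by
  rw [isVectorState_circleState hn m c, shiftRep_word_basisVec, inner_smul_right,
    inner_basisVec_left, basisVec_apply]
  split_ifs with h1 h2 h2
  · rw [mul_one, h2]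
    exact congrArg _ (weight_initial_periodicSeq hn m hm c)
  · refine absurd (List.ofFn_injective ?_) h2
    simpa [initial] using (append_eq_iff.1 h1.symm).1
  · refine absurd (append_eq_iff.2 ⟨?_, ?_⟩).symm h1
    · rw [h2]; simp [initial]
    · rw [List.length_ofFn, shift_periodicSeq]
  · rw [mul_zero]

theorem circleState_word_initial (hm : 1 ≤ m) (c : Circle) :
    (circleState hn m c).1 (word (initial (periodicSeq hn m) m)) = c := by
  rw [initial, circleState_word hn hm, if_pos rfl]

theorem isSubCuntzState_circleVector_iff (hm : 1 ≤ m) (c : Circle)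
    (ω : State (CuntzAlgebra n)) :
    IsSubCuntzState (circleVector hn m c) ω ↔ ω = circleState hn m c := by
  classical
  constructor
  · rintro ⟨-, -, h⟩
    refine state_eq_of_period hm (shift_periodicSeq hn m)
      (modEq_of_shift_periodicSeq_eq hn m hm) (Circle.norm_coe c) ?_
      (circleState_word_initial hn hm c)
    rw [initial, h, circleVector_apply, if_pos rfl, star_star]
  · rintro rfl
    refine ⟨hm, ?_, fun J => ?_⟩
    · rw [circleVector, lp.norm_single (by norm_num), norm_star, Circle.norm_coe]
    · rw [circleState_word hn hm, circleVector_apply]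
      split_ifs
      · rw [star_star]
      · rw [star_zero]

theorem isPure_circleState (hm : 1 ≤ m) (c : Circle) : IsPure (circleState hn m c) :=
  isPure_of_period hm (shift_periodicSeq hn m) (modEq_of_shift_periodicSeq_eq hn m hm)
    (Circle.norm_coe c) (circleState_word_initial hn hm c)

theorem isMinimal_circleState (hm : 1 ≤ m) (c : Circle) :
    IsMinimal (circleState hn m c) ∧ kappa (circleState hn m c) = m :=
  isMinimal_of_period hm (shift_periodicSeq hn m) (modEq_of_shift_periodicSeq_eq hn m hm)
    (isVectorState_circleState hn m c)

theorem circleState_injective (hm : 1 ≤ m) : Function.Injective (circleState hn m) :=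
    fun c c' h => by
  have := circleState_word_initial hn hm c
  rw [h, circleState_word_initial hn hm] at this
  exact (Circle.ext this).symm

theorem circleState_eq_of_equivalent {c c' : Circle}
    (h : Equivalent (circleState hn m c) (circleState hn m c')) :
    circleState hn m c = circleState hn m c' :=
  (equivalent_basisVec (isVectorState_circleState hn m c) (isVectorState_circleState hn m c') h).2
    rfl

end SubCuntz

end

section

variable {n : ℕ∞}

/-! ### Representatives of the tail classes -/

/-- For fixed preperiod and period, the sequence is determined by finitely many entries. -/
theorem countable_eventuallyPeriodic : {y : Seq n | EventuallyPeriodic y}.Countable := by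
  have h : {y : Seq n | EventuallyPeriodic y} ⊆
      ⋃ q : ℕ × ℕ, {y | 1 ≤ q.2 ∧ ∀ i, q.1 ≤ i → y (i + q.2) = y i} := by
    rintro y ⟨i₀, p, hp⟩
    exact Set.mem_iUnion.2 ⟨(i₀, p), hp⟩
  refine (Set.countable_iUnion fun q => ?_).mono h
  refine Set.MapsTo.countable_of_injOn (t := Set.univ)
    (f := fun (y : Seq n) (j : Fin (q.1 + q.2)) => y j) (fun _ _ => Set.mem_univ _) ?_
    Set.countable_univ
  rintro x ⟨hq, hx⟩ y ⟨-, hy⟩ hxy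
  ext1 i
  induction i using Nat.strong_induction_on with
  | _ i ih =>
    by_cases hi : i < q.1 + q.2
    · exact congrFun hxy ⟨i, hi⟩
    · obtain ⟨j, rfl⟩ : ∃ j, i = j + q.2 := ⟨i - q.2, by omega⟩
      rw [hx j (by omega), hy j (by omega), ih j (by omega)]

theorem mk_seq (hn : 2 ≤ n) : Cardinal.mk (Seq n) = Cardinal.continuum := by
  rw [← Cardinal.power_def, Cardinal.mk_nat]
  refine le_antisymm ?_ ?_
  · rw [← Cardinal.aleph0_power_aleph0]
    exact Cardinal.power_le_power_right Cardinal.mk_le_aleph0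
  · rw [← Cardinal.two_power_aleph0]
    exact Cardinal.power_le_power_right
      (Cardinal.two_le_iff.2 ⟨idxOne hn, idxTwo hn, idxOne_ne_idxTwo hn⟩)

/-- There is a set of representatives of the tail classes of sequences that are not eventually
periodic. -/
theorem exists_representatives (n : ℕ∞) : ∃ R : Set (Seq n), (∀ x ∈ R, ¬ EventuallyPeriodic x) ∧
    ∀ y, ¬ EventuallyPeriodic y → ∃! x, x ∈ R ∧ TailEquiv x y := by
  let s : Setoid {y : Seq n // ¬ EventuallyPeriodic y} :=
    ⟨fun x y => TailEquiv x.1 y.1, fun x => TailEquiv.refl _, TailEquiv.symm, TailEquiv.trans⟩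
  refine ⟨Set.range fun q : Quotient s => q.out.1, ?_, fun y hy => ?_⟩
  · rintro _ ⟨q, rfl⟩
    exact q.out.2
  · refine ⟨(Quotient.mk s ⟨y, hy⟩).out.1, ⟨⟨_, rfl⟩, Quotient.mk_out (s := s) ⟨y, hy⟩⟩, ?_⟩
    rintro _ ⟨⟨q, rfl⟩, hq⟩
    have : q = Quotient.mk s ⟨y, hy⟩ := by
      rw [← q.out_eq]
      exact Quotient.sound hq
    rw [this]

theorem mk_representatives (hn : 2 ≤ n) {R : Set (Seq n)}
    (hR : ∀ y, ¬ EventuallyPeriodic y → ∃! x, x ∈ R ∧ TailEquiv x y) :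
    Cardinal.mk R = Cardinal.continuum := by
  refine le_antisymm ((Cardinal.mk_set_le R).trans (mk_seq hn).le) ?_
  by_contra hlt
  push Not at hlt
  -- Every sequence that is not eventually periodic arises from some `x ∈ R` by removing an initial
  -- segment and prepending a word, a countable choice for each `x`. So fewer than continuum many
  -- representatives could not cover `Λ`.
  let F : List (Idx n) × ℕ × R → Seq n := fun q => append q.1 (shift q.2.2.1 q.2.1)
  have hcover : (Set.univ : Set (Seq n)) ⊆ {y | EventuallyPeriodic y} ∪ Set.range F := by
    intro y _
    by_cases hy : EventuallyPeriodic y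
    · exact Or.inl hy
    · obtain ⟨x, ⟨hx, hxy⟩, -⟩ := hR y hy
      obtain ⟨p, q, hpq⟩ := tailEquiv_iff.1 hxy
      refine Or.inr ⟨(initial y q, p, ⟨x, hx⟩), ?_⟩
      change append (initial y q) (shift x p) = y
      rw [hpq, append_initial]
  have h1 := (Cardinal.mk_le_mk_of_subset hcover).trans (Cardinal.mk_union_le _ _)
  rw [Cardinal.mk_univ, mk_seq hn] at h1
  refine h1.not_gt (Cardinal.add_lt_of_lt Cardinal.aleph0_le_continuum ?_ ?_)
  · exact (Cardinal.le_aleph0_iff_set_countable.2 countable_eventuallyPeriodic).trans_lt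
      Cardinal.aleph0_lt_continuum
  · refine Cardinal.mk_range_le.trans_lt ?_
    rw [Cardinal.mk_prod, Cardinal.mk_prod]
    simp only [Cardinal.lift_id]
    exact Cardinal.mul_lt_of_lt Cardinal.aleph0_le_continuum
      (Cardinal.mk_le_aleph0.trans_lt Cardinal.aleph0_lt_continuum)
      (Cardinal.mul_lt_of_lt Cardinal.aleph0_le_continuum
        (Cardinal.mk_le_aleph0.trans_lt Cardinal.aleph0_lt_continuum) hlt)

theorem mk_circle : Cardinal.mk Circle = Cardinal.continuum := by
  rw [Cardinal.mk_congr Circle.argEquiv,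
    Cardinal.mk_Ioc_real (by linarith [Real.pi_pos])]

/-- The parameters live in `Type` and the states in `Type 1`, so the cardinals are compared after a
lift, which fixes the continuum. -/
theorem mk_range_eq_continuum {α : Type} {β : Type 1} {f : α → β} (hf : Function.Injective f)
    (hα : Cardinal.mk α = Cardinal.continuum) :
    Cardinal.mk (Set.range f) = Cardinal.continuum := by
  have := Cardinal.mk_range_eq_of_injective hf
  rwa [hα, Cardinal.lift_continuum, Cardinal.lift_id'.{0, 1}] at this

end

end Cuntz

end

/-! ### The two families of states -/

theorem theorem3p14 (n d : ℕ∞) (hn : 2 ≤ n) (hd : 1 ≤ d) :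
    ∃ S : Set (Cuntz.State (Cuntz.CuntzAlgebra n)),
      Cardinal.mk S = Cardinal.continuum ∧
      (∀ ω ∈ S, Cuntz.IsPure ω ∧ Cuntz.IsMinimal ω ∧ Cuntz.kappa ω = d) ∧
      (∀ ω ∈ S, ∀ ω' ∈ S, ω ≠ ω' → ¬ Cuntz.Equivalent ω ω') ∧
      (∀ m : ℕ, d = m →
        ∃ ρ : Circle → Cuntz.State (Cuntz.CuntzAlgebra n),
          (∀ c ω, Cuntz.IsSubCuntzState (Cuntz.circleVector hn m c) ω ↔ ω = ρ c) ∧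
          S = Set.range ρ) ∧
      (d = ⊤ →
        ∃ (P : Cuntz.CuntzAlgebra n →⋆ₐ[ℂ] (Cuntz.SeqSpace n →L[ℂ] Cuntz.SeqSpace n))
          (R : Set (Cuntz.Seq n)),
          Cuntz.IsShiftRepresentation P ∧
          (∀ x ∈ R, ¬ Cuntz.EventuallyPeriodic x) ∧
          (∀ y, ¬ Cuntz.EventuallyPeriodic y → ∃! x, x ∈ R ∧ Cuntz.TailEquiv x y) ∧
          S = {ω | ∃ x ∈ R, Cuntz.IsVectorState P (Cuntz.basisVec x) ω}) := by
  have : Nonempty (Cuntz.Idx n) := ⟨Cuntz.idxOne hn⟩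
  rcases eq_or_ne d ⊤ with rfl | hd'
  · obtain ⟨R, hR, hR'⟩ := Cuntz.exists_representatives n
    have hvec := fun x : R => Cuntz.isVectorState_vectorState (Cuntz.shiftRep 1)
      (Cuntz.basisVec x.1) (Cuntz.norm_basisVec x.1)
    have heq : ∀ x x' : R, Cuntz.TailEquiv x.1 x'.1 → x = x' := fun x x' h =>
      Subtype.ext ((hR' x'.1 (hR _ x'.2)).unique ⟨x.2, h⟩ ⟨x'.2, Cuntz.TailEquiv.refl _⟩)
    refine ⟨Set.range fun x : R => Cuntz.vectorState (Cuntz.shiftRep 1) (Cuntz.basisVec x.1)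
      (Cuntz.norm_basisVec x.1), Cuntz.mk_range_eq_continuum (fun x x' h => ?_)
      (Cuntz.mk_representatives hn hR'), ?_, ?_, fun m hm => absurd hm (ENat.top_ne_natCast m),
      fun _ => ⟨Cuntz.shiftRep 1, R, Cuntz.isShiftRepresentation_shiftRep_one, hR, hR', ?_⟩⟩
    · refine heq x x' (Cuntz.equivalent_basisVec (hvec x) (hvec x') ?_).1
      have h' : Cuntz.vectorState (Cuntz.shiftRep 1) (Cuntz.basisVec x.1)
        (Cuntz.norm_basisVec x.1) = Cuntz.vectorState (Cuntz.shiftRep 1) (Cuntz.basisVec x'.1)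
        (Cuntz.norm_basisVec x'.1) := h
      rw [h']
      exact Cuntz.Equivalent.refl _
    · rintro _ ⟨x, rfl⟩
      exact ⟨Cuntz.isPure_of_not_eventuallyPeriodic (hR _ x.2) (hvec x),
        Cuntz.isMinimal_of_not_eventuallyPeriodic (hR _ x.2) (hvec x)⟩
    · rintro _ ⟨x, rfl⟩ _ ⟨x', rfl⟩ hne he
      refine hne ?_
      rw [heq x x' (Cuntz.equivalent_basisVec (hvec x) (hvec x') he).1]
    · ext ω
      constructor
      · rintro ⟨x, rfl⟩
        exact ⟨x.1, x.2, hvec x⟩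
      · rintro ⟨x, hx, h⟩
        exact ⟨⟨x, hx⟩, Cuntz.state_ext fun a => (h a).symm⟩
  · lift d to ℕ using hd'
    have hm : 1 ≤ d := by exact_mod_cast hd
    refine ⟨Set.range (Cuntz.circleState hn d),
      Cuntz.mk_range_eq_continuum (Cuntz.circleState_injective hn hm) Cuntz.mk_circle, ?_, ?_,
      fun m h => ?_, fun h => absurd h (ENat.natCast_ne_top d)⟩
    · rintro _ ⟨c, rfl⟩
      exact ⟨Cuntz.isPure_circleState hn hm c, Cuntz.isMinimal_circleState hn hm c⟩
    · rintro _ ⟨c, rfl⟩ _ ⟨c', rfl⟩ hne he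
      exact hne (Cuntz.circleState_eq_of_equivalent hn he)
    · obtain rfl : d = m := by exact_mod_cast h
      exact ⟨Cuntz.circleState hn d, Cuntz.isSubCuntzState_circleVector_iff hn hm, rfl⟩
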